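/- Let $X$ be a smooth (Hausdorff) manifold of dimension $n$ and let $\pi\colon X\to I=(-1,1)$ be a smooth semi-stable degeneration, i.e. a proper smooth function such that $\pi$ is a submersion at every point of $X\setminus\pi^{-1}(0)$ and every $p\in X$ with $\pi(p)=0$ is the centre of a smooth chart in which $\pi(x)=x_1\cdots x_k$ for some $1\le k\le n$. Write $X_t=\pi^{-1}(t)$. Let $\alpha\colon\widetilde X\to X$ be the real-oriented blow-up of $X$ along the normal crossing divisor $X_0$: the space glued from the following local models over the smooth charts $U\to V\subset\mathbb R^n$ in which $X_0$ is given by $\{x_1\cdots x_k=0\}$ for some $0\le k\le n$. The local model over such a chart is the part over $V$ of $$(\mathbb R_{\le 0}\sqcup\mathbb R_{\ge 0})^k\times\mathbb R^{n-k}\longrightarrow\mathbb R^n ,$$ that is, the disjoint union over $\epsilon\in\{\pm1\}^k$ of the sets $\{x\in V:\epsilon_i x_i\ge 0,\ i=1,\dots,k\}$. Points $(\epsilon,x)$ and $(\epsilon',x')$ of two local models are identified when they lie over the same $p\in X$ and the open orthants $\{\epsilon_i x_i>0\ \forall i\}$ and $\{\epsilon'_i x'_i>0\ \forall i\}$ define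 the same germ at $p$; $\widetilde X$ carries the quotient topology. Let $\beta\colon\widetilde I=(-1,0]\sqcup[0,1)\to I$ be the real-oriented blow-up of $I$ at $0$, let $0^+$ be the copy of $0$ in $[0,1)$, and write $[0^+,1)\subset\widetilde I$ for the second summand. Then there is a unique continuous map $\widetilde\pi\colon\widetilde X\to\widetilde I$ with $\beta\circ\widetilde\pi=\pi\circ\alpha$ (the real-oriented blow-up of $\pi$). Set $\widetilde X^+=\widetilde\pi^{-1}([0^+,1))$ and $\widetilde X_0^+=\widetilde\pi^{-1}(0^+)$. There exists a homeomorphism $$H\colon\widetilde X_0^+\times[0,1)\to\widetilde X^+$$ such that $\widetilde\pi(H(x,t))=t\in[0^+,1)$ for all $(x,t)\in\widetilde X_0^+\times[0,1)$. In particular, $\widetilde X_0^+$ is homeomorphic to $X_t$ for every $t\in(0,1)$. -/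

import Mathlib

open Set Filter Topology
open scoped Manifold ContDiff

/-- A normal crossing function on a smooth `n`-manifold: a smooth function that around each of its
zeros `p` equals `x₁ ⋯ xₖ`, `1 ≤ k ≤ n`, in some smooth chart centred at `p`. -/
structure IsNormalCrossingFunction (n : ℕ) {X : Type*} [TopologicalSpace X]
    [ChartedSpace (EuclideanSpace ℝ (Fin n)) X] (ρ : X → ℝ) : Prop where
  smooth : ContMDiff (𝓡 n) 𝓘(ℝ, ℝ) ∞ ρ
  exists_chart : ∀ p : X, ρ p = 0 →
    ∃ e ∈ IsManifold.maximalAtlas (𝓡 n) ∞ X, p ∈ e.source ∧ e p = 0 ∧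
      ∃ (k : ℕ) (hk : k ≤ n), 1 ≤ k ∧
        ∀ q ∈ e.source, ρ q = ∏ i : Fin k, e q (Fin.castLE hk i)

/-- A smooth semi-stable degeneration `π : X → (-1, 1)`: a proper normal crossing function which is
a submersion away from the fibre over `0`. -/
structure IsSmoothSemistableDegeneration (n : ℕ) {X : Type*} [TopologicalSpace X]
    [ChartedSpace (EuclideanSpace ℝ (Fin n)) X] (π : X → Ioo (-1 : ℝ) 1) : Prop where
  isProper : IsProperMap π
  normalCrossing : IsNormalCrossingFunction n (fun p => (π p : ℝ))
  submersive : ∀ p : X, (π p : ℝ) ≠ 0 →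
    Function.Surjective (mfderiv (𝓡 n) 𝓘(ℝ, ℝ) (fun q => (π q : ℝ)) p)

/-- A smooth chart of `X` in which the set `D` is `{x₁ ⋯ xₖ = 0}`. The case `k = 0` is allowed
and means that the chart does not meet `D`. -/
structure NormalCrossingChart (n : ℕ) {X : Type*} [TopologicalSpace X]
    [ChartedSpace (EuclideanSpace ℝ (Fin n)) X] (D : Set X) where
  chart : OpenPartialHomeomorph X (EuclideanSpace ℝ (Fin n))
  mem_atlas : chart ∈ IsManifold.maximalAtlas (𝓡 n) ∞ X
  k : ℕ
  k_le : k ≤ n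
  mem_iff : ∀ p ∈ chart.source, p ∈ D ↔ ∏ i : Fin k, chart p (Fin.castLE k_le i) = 0

namespace NormalCrossingChart

/-- The part of the chart domain lying in the closed orthant
`{ε₁ x₁ ≥ 0, …, εₖ xₖ ≥ 0}`. -/
def closedOrthant {n : ℕ} {X : Type*} [TopologicalSpace X]
    [ChartedSpace (EuclideanSpace ℝ (Fin n)) X] {D : Set X} (c : NormalCrossingChart n D)
    (ε : Fin c.k → ℤˣ) : Set X :=
  {p | p ∈ c.chart.source ∧
    ∀ i : Fin c.k, 0 ≤ ((ε i : ℤ) : ℝ) * c.chart p (Fin.castLE c.k_le i)}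

/-- The part of the chart domain lying in the open orthant
`{ε₁ x₁ > 0, …, εₖ xₖ > 0}`. -/
def openOrthant {n : ℕ} {X : Type*} [TopologicalSpace X]
    [ChartedSpace (EuclideanSpace ℝ (Fin n)) X] {D : Set X} (c : NormalCrossingChart n D)
    (ε : Fin c.k → ℤˣ) : Set X :=
  {p | p ∈ c.chart.source ∧
    ∀ i : Fin c.k, 0 < ((ε i : ℤ) : ℝ) * c.chart p (Fin.castLE c.k_le i)}

end NormalCrossingChart

/-- The disjoint union of the local models of the real-oriented blow-up: for each normal crossing
chart `U → V ⊆ ℝⁿ`, the disjoint union over `ε ∈ {±1}ᵏ` of the closed orthants of `V`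
(carried back to `U` by the chart). In the chart this is the part over `V` of
`(ℝ_{≤0} ⊔ ℝ_{≥0})ᵏ × ℝⁿ⁻ᵏ → ℝᵏ × ℝⁿ⁻ᵏ`. -/
abbrev BlowupPieces (n : ℕ) {X : Type*} [TopologicalSpace X]
    [ChartedSpace (EuclideanSpace ℝ (Fin n)) X] (D : Set X) :=
  Σ c : NormalCrossingChart n D, Σ ε : Fin c.k → ℤˣ, c.closedOrthant ε

namespace BlowupPieces

/-- The underlying point in `X` of a point of a local model. -/
def point {n : ℕ} {X : Type*} [TopologicalSpace X]
    [ChartedSpace (EuclideanSpace ℝ (Fin n)) X] {D : Set X} (x : BlowupPieces n D) : X :=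
  x.2.2

/-- The local side of `D` selected by a point `(ε, p)` of a local model: the germ at `p` of the
open orthant labelled by `ε`, encoded as the filter of its relative neighbourhoods of `p`. -/
def side {n : ℕ} {X : Type*} [TopologicalSpace X]
    [ChartedSpace (EuclideanSpace ℝ (Fin n)) X] {D : Set X} (x : BlowupPieces n D) : Filter X :=
  𝓝[x.1.openOrthant x.2.1] x.point

end BlowupPieces

/-- Points of two local models are glued when they lie over the same point of `X` and select the
same local side of `D` there. -/
def blowupSetoid (n : ℕ) {X : Type*} [TopologicalSpace X]
    [ChartedSpace (EuclideanSpace ℝ (Fin n)) X] (D : Set X) : Setoid (BlowupPieces n D) where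
  r x y := x.point = y.point ∧ x.side = y.side
  iseqv :=
    { refl := fun _ => ⟨rfl, rfl⟩
      symm := fun h => ⟨h.1.symm, h.2.symm⟩
      trans := fun h h' => ⟨h.1.trans h'.1, h.2.trans h'.2⟩ }

/-- The real-oriented blow-up of `X` along a (closed) normal crossing divisor `D`, obtained by
gluing the local models over all normal crossing charts. -/
def RealOrientedBlowup (n : ℕ) {X : Type*} [TopologicalSpace X]
    [ChartedSpace (EuclideanSpace ℝ (Fin n)) X] (D : Set X) :=
  Quotient (blowupSetoid n D)

namespace RealOrientedBlowup

/-- The gluing (quotient) topology. -/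
instance instTopologicalSpace {n : ℕ} {X : Type*} [TopologicalSpace X]
    [ChartedSpace (EuclideanSpace ℝ (Fin n)) X] {D : Set X} :
    TopologicalSpace (RealOrientedBlowup n D) :=
  inferInstanceAs (TopologicalSpace (Quotient (blowupSetoid n D)))

/-- The blow-down map `α`. -/
def blowDown {n : ℕ} {X : Type*} [TopologicalSpace X]
    [ChartedSpace (EuclideanSpace ℝ (Fin n)) X] {D : Set X} (x : RealOrientedBlowup n D) : X :=
  Quotient.lift BlowupPieces.point (fun _ _ h => And.left h) x

end RealOrientedBlowup

/-- The real-oriented blow-up `(-1, 0] ⊔ [0, 1)` of the interval `(-1, 1)` at `0`. -/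
abbrev BlownUpInterval := Ioc (-1 : ℝ) 0 ⊕ Ico (0 : ℝ) 1

namespace BlownUpInterval

/-- The blow-down map `β : (-1, 0] ⊔ [0, 1) → (-1, 1)`. -/
def blowDown : BlownUpInterval → Ioo (-1 : ℝ) 1 :=
  Sum.elim (fun t => ⟨t, t.2.1, t.2.2.trans_lt one_pos⟩)
    (fun t => ⟨t, neg_one_lt_zero.trans_le t.2.1, t.2.2⟩)

/-- The positive copy `0⁺` of zero. -/
def zeroPos : BlownUpInterval := Sum.inr ⟨0, le_refl 0, one_pos⟩

/-- The positive half `[0⁺, 1)`. -/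
def positiveHalf : Set BlownUpInterval := range Sum.inr

end BlownUpInterval

/-- The special fibre `X₀` of `π : X → (-1, 1)`. -/
def specialFibre {X : Type*} (π : X → Ioo (-1 : ℝ) 1) : Set X := {p | (π p : ℝ) = 0}

/-- `π'` is a real-oriented blow-up of the map `π`: a continuous map between the
real-oriented blow-ups of source and target with `β ∘ π' = π ∘ α`. -/
structure IsBlowupOfMap (n : ℕ) {X : Type*} [TopologicalSpace X]
    [ChartedSpace (EuclideanSpace ℝ (Fin n)) X] (π : X → Ioo (-1 : ℝ) 1)
    (π' : RealOrientedBlowup n (specialFibre π) → BlownUpInterval) : Prop where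
  continuous : Continuous π'
  comm : ∀ x, BlownUpInterval.blowDown (π' x) = π x.blowDown

/-! The argument is Ehresmann's, with one obstruction: at a corner of the blow-up the lifted map has
the form `|x₁| ⋯ |xₖ|` on a closed orthant, so its differential vanishes there when `k ≥ 2` and no
vector field can lift `∂/∂t`. A homeomorphism does not need such a lift. It suffices to have a field
pointing strictly into every orthant, along which `π` increases wherever it is positive. Its flow
moves a corner point immediately into the open orthant, `π` is strictly increasing along the flow
even where its derivative is zero, and curves can be parametrized by the level of `π` instead of by
time.

Both conditions on the field are convex, so local choices are summed with a partition of unity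
(`exists_ascending_vectorField`). The result jumps across the special fibre, but on the germ of each
orthant it agrees with a field that is `C¹` in a full neighbourhood. That two charts have the same
orthant germs, and agree on which vectors point inward, is
`NormalCrossingChart.exists_nhdsWithin_eq` and `NormalCrossingChart.dirDeriv_coord_pos`.

Near a boundary point the `C¹` extension of the field has an ordinary flow, and `π` is replaced by a
continuous function that is nonnegative exactly on the orthant and still increases along this flow
(`extendedProd`). The flow box of `exists_flowBox` then gives local transport to nearby levels
inside the orthant. Fibres are compact because `π` and the blow-down map are proper, so boxes have
uniform width near each fibre, and connectedness of `[0, 1)` yields a transport `T` to all levels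
(`exists_transport_of_relation_pos`). The trivialization is `(x, t) ↦ T (x, t)`, with inverse `y ↦
(T (y, 0), p y)`. Over `t > 0` the blow-down map identifies the level with `X_t`.

The lifted map exists because `π` has constant sign on the germ of each orthant. It is unique
because the complement of the special fibre is dense in the blow-up. -/

/-! ### Transport along the leaves of a proper function -/

/-- If `p` is proper over compact subintervals of `[0, 1)` and the fibre over `t₀` lies in an open
set `V`, then so do all nearby fibres. -/
theorem exists_isOpen_preimage_subset_of_isCompact {Y : Type*} [TopologicalSpace Y]
    {p : Y → ℝ} (hp : Continuous p) (h01 : ∀ y, p y ∈ Ico (0 : ℝ) 1)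
    (hK : ∀ c < 1, IsCompact (p ⁻¹' Icc 0 c)) {V : Set Y} (hV : IsOpen V) {t₀ : ℝ}
    (ht₀ : t₀ ∈ Ico (0 : ℝ) 1) (h : p ⁻¹' {t₀} ⊆ V) :
    ∃ J : Set ℝ, IsOpen J ∧ t₀ ∈ J ∧ p ⁻¹' J ⊆ V := by
  obtain ⟨c, htc, hc⟩ := exists_between ht₀.2
  have hcomp : IsCompact (p '' (p ⁻¹' Icc 0 c \ V)) := ((hK c hc).diff hV).image hp
  refine ⟨Iio c \ p '' (p ⁻¹' Icc 0 c \ V), isOpen_Iio.sdiff hcomp.isClosed, ⟨htc, ?_⟩, ?_⟩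
  · rintro ⟨y, ⟨-, hy⟩, rfl⟩
    exact hy (h rfl)
  · rintro y ⟨hy, hy'⟩
    by_contra hyV
    exact hy' ⟨y, ⟨⟨(h01 y).1, le_of_lt hy⟩, hyV⟩, rfl⟩

/-- A proper function `p : Y → [0, 1)` with an equivalence relation whose classes meet every fibre
at most once, and which locally has continuous sections through every point, has a continuous
global transport along the classes. -/
theorem exists_transport_of_relation {Y : Type*} [TopologicalSpace Y]
    {p : Y → ℝ} (hp : Continuous p) (h01 : ∀ y, p y ∈ Ico (0 : ℝ) 1)
    (hK : ∀ c < 1, IsCompact (p ⁻¹' Icc 0 c)) (S : Y → Y → Prop)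
    (hsymm : ∀ y z, S y z → S z y) (htrans : ∀ x y z, S x y → S y z → S x z)
    (huniq : ∀ y z, S y z → p y = p z → y = z)
    (hbox : ∀ y₀, ∃ N ∈ 𝓝 y₀, ∃ J : Set ℝ, IsOpen J ∧ p y₀ ∈ J ∧ ∃ τ : Y × ℝ → Y,
      ContinuousOn τ (N ×ˢ (J ∩ Ico 0 1)) ∧
      ∀ y ∈ N, ∀ t ∈ J ∩ Ico 0 1, p (τ (y, t)) = t ∧ S y (τ (y, t))) :
    ∃ T : Y × ℝ → Y, ContinuousOn T (univ ×ˢ Ico 0 1) ∧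
      (∀ y, T (y, p y) = y) ∧ (∀ y, ∀ t ∈ Ico (0 : ℝ) 1, p (T (y, t)) = t) ∧
      ∀ y, ∀ s ∈ Ico (0 : ℝ) 1, ∀ t ∈ Ico (0 : ℝ) 1, T (T (y, s), t) = T (y, t) := by
  classical
  choose N hN J hJo hJ τ hτc hτ using hbox
  -- `T (y, t)` is the point of the class of `y` on level `t`. By `huniq` the choice is irrelevant,
  -- and `hex` below shows that the default value is never taken for `t` in `[0, 1)`.
  let T : Y × ℝ → Y := fun x => if h : ∃ z, S x.1 z ∧ p z = x.2 then h.choose else x.1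
  have hT : ∀ {y z : Y} {t : ℝ}, S y z → p z = t → T (y, t) = z := by
    intro y z t hS hz
    have h : ∃ z, S y z ∧ p z = t := ⟨z, hS, hz⟩
    have : T (y, t) = h.choose := dif_pos h
    rw [this]
    exact huniq _ _ (htrans _ _ _ (hsymm _ _ h.choose_spec.1) hS) (h.choose_spec.2.trans hz.symm)
  -- common boxes near a fibre
  have hloc : ∀ t₀ ∈ Ico (0 : ℝ) 1, ∃ I : Set ℝ, IsOpen I ∧ t₀ ∈ I ∧ ∀ y, p y ∈ I →
      ∃ y₀, N y₀ ∈ 𝓝 y ∧ I ⊆ J y₀ := by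
    intro t₀ ht₀
    have hcpt : IsCompact (p ⁻¹' {t₀}) := by
      obtain ⟨c, htc, hc⟩ := exists_between ht₀.2
      refine (hK c hc).of_isClosed_subset (isClosed_singleton.preimage hp) ?_
      rintro y rfl
      exact ⟨(h01 y).1, htc.le⟩
    obtain ⟨F, hFt, hF⟩ := hcpt.elim_nhds_subcover (fun y => interior (N y))
      (fun y _ => interior_mem_nhds.2 (hN y))
    obtain ⟨I, hIo, hI, hIV⟩ := exists_isOpen_preimage_subset_of_isCompact hp h01 hK
      (isOpen_biUnion fun y (_ : y ∈ F) => isOpen_interior (s := N y)) ht₀ hF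
    refine ⟨I ∩ ⋂ y ∈ F, J y, hIo.inter (isOpen_biInter_finset fun y _ => hJo y),
      ⟨hI, mem_iInter₂.2 fun y hy => ?_⟩, ?_⟩
    · rw [← show p y = t₀ from hFt y hy]; exact hJ y
    · rintro y ⟨hy, -⟩
      obtain ⟨y₀, hy₀, hyy⟩ := mem_iUnion₂.1 (hIV hy)
      exact ⟨y₀, mem_interior_iff_mem_nhds.1 hyy,
        inter_subset_right.trans (iInter₂_subset y₀ hy₀)⟩
  -- existence of the transported point
  have hex : ∀ y, ∀ t ∈ Ico (0 : ℝ) 1, ∃ z, S y z ∧ p z = t := by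
    intro y t ht
    -- The levels met by the class of `y` form an open and closed subset of `[0, 1)`: boxes have
    -- uniform width near a fibre, so a class meeting one level of `I` meets all of them.
    have key := isPreconnected_Ico.induction₂ (s := Ico (0 : ℝ) 1)
      (fun a b => (∃ z, S y z ∧ p z = a) ↔ ∃ z, S y z ∧ p z = b) (fun t₀ ht₀ => by
        obtain ⟨I, hIo, hI, hIb⟩ := hloc t₀ ht₀
        have step : ∀ a ∈ I ∩ Ico (0 : ℝ) 1, ∀ b ∈ I ∩ Ico (0 : ℝ) 1,
            (∃ z, S y z ∧ p z = a) → ∃ z, S y z ∧ p z = b := by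
          rintro a ha b hb ⟨z, hz, rfl⟩
          obtain ⟨y₀, hy₀, hIJ⟩ := hIb z ha.1
          have := hτ y₀ z (mem_of_mem_nhds hy₀) b ⟨hIJ hb.1, hb.2⟩
          exact ⟨_, htrans _ _ _ hz this.2, this.1⟩
        filter_upwards [inter_mem_nhdsWithin (Ico (0 : ℝ) 1) (hIo.mem_nhds hI)] with b hb
        exact ⟨step _ ⟨hI, ht₀⟩ _ ⟨hb.2, hb.1⟩, step _ ⟨hb.2, hb.1⟩ _ ⟨hI, ht₀⟩⟩)
      (fun _ _ _ _ _ _ h h' => h.trans h') (fun _ _ _ _ h => h.symm) (h01 y) ht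
    -- `S` is not assumed reflexive, so the point of the class on the initial level also comes from
    -- a box.
    obtain ⟨y₀, hy₀, hIJ⟩ := (hloc (p y) (h01 y)).choose_spec.2.2 y (hloc (p y) (h01 y)).choose_spec.2.1
    have h1 := hτ y₀ y (mem_of_mem_nhds hy₀) (p y)
      ⟨hIJ (hloc (p y) (h01 y)).choose_spec.2.1, h01 y⟩
    exact key.1 ⟨_, h1.2, h1.1⟩
  have hTS : ∀ y, ∀ t ∈ Ico (0 : ℝ) 1, S y (T (y, t)) ∧ p (T (y, t)) = t := by
    intro y t ht
    obtain ⟨z, hz, hpz⟩ := hex y t ht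
    rw [hT hz hpz]; exact ⟨hz, hpz⟩
  have hTT : ∀ y, ∀ s ∈ Ico (0 : ℝ) 1, ∀ t ∈ Ico (0 : ℝ) 1, T (T (y, s), t) = T (y, t) :=
    fun y s hs t ht => hT (htrans _ _ _ (hsymm _ _ (hTS y s hs).1) (hTS y t ht).1) (hTS y t ht).2
  have hTcont : ∀ t₀ ∈ Ico (0 : ℝ) 1, ∃ I : Set ℝ, IsOpen I ∧ t₀ ∈ I ∧ ∀ y, p y ∈ I →
      ∀ t ∈ I ∩ Ico 0 1, ContinuousWithinAt T (univ ×ˢ Ico 0 1) (y, t) := by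
    intro t₀ ht₀
    obtain ⟨I, hIo, hI, hIb⟩ := hloc t₀ ht₀
    refine ⟨I, hIo, hI, fun y hy t ht => ?_⟩
    obtain ⟨y₀, hy₀, hIJ⟩ := hIb y hy
    have hmem : N y₀ ×ˢ (J y₀ ∩ Ico 0 1) ∈ 𝓝[univ ×ˢ Ico (0 : ℝ) 1] (y, t) := by
      rw [nhdsWithin_prod_eq, nhdsWithin_univ]
      refine prod_mem_prod hy₀ ?_
      rw [inter_comm]
      exact inter_mem_nhdsWithin _ ((hJo y₀).mem_nhds (hIJ ht.1))
    have hc : ContinuousWithinAt (τ y₀) (N y₀ ×ˢ (J y₀ ∩ Ico 0 1)) (y, t) :=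
      hτc y₀ (y, t) ⟨mem_of_mem_nhds hy₀, hIJ ht.1, ht.2⟩
    have heq : ∀ x ∈ N y₀ ×ˢ (J y₀ ∩ Ico 0 1), T x = τ y₀ x := fun x hx =>
      hT (hτ y₀ x.1 hx.1 x.2 hx.2).2 (hτ y₀ x.1 hx.1 x.2 hx.2).1
    exact (hc.congr heq (heq _ ⟨mem_of_mem_nhds hy₀, hIJ ht.1, ht.2⟩)).mono_of_mem_nhdsWithin hmem
  -- continuity is propagated from one level to a nearby one
  have hprop : ∀ y s t, s ∈ Ico (0 : ℝ) 1 → t ∈ Ico (0 : ℝ) 1 →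
      ContinuousAt (fun y' => T (y', s)) y →
      ContinuousWithinAt T (univ ×ˢ Ico 0 1) (T (y, s), t) →
      ContinuousWithinAt T (univ ×ˢ Ico 0 1) (y, t) := by
    intro y s t hs ht h1 h2
    have h3 : ContinuousWithinAt (fun x : Y × ℝ => (T (x.1, s), x.2)) (univ ×ˢ Ico 0 1) (y, t) :=
      (ContinuousAt.comp (f := Prod.fst) (x := (y, t)) h1 continuousAt_fst).continuousWithinAt.prodMk
        continuousWithinAt_snd
    have h4 := ContinuousWithinAt.comp (f := fun x : Y × ℝ => (T (x.1, s), x.2)) (x := (y, t))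
      (g := T) (t := univ ×ˢ Ico 0 1) h2 h3 (fun x hx => ⟨mem_univ _, hx.2⟩)
    exact h4.congr (fun x hx => (hTT x.1 s hs x.2 hx.2).symm) (hTT y s hs t ht).symm
  have hslice : ∀ y t, t ∈ Ico (0 : ℝ) 1 → ContinuousWithinAt T (univ ×ˢ Ico 0 1) (y, t) →
      ContinuousAt (fun y' => T (y', t)) y := by
    intro y t ht h
    have := ContinuousWithinAt.comp (f := fun y' : Y => (y', t)) (x := y) (g := T) (s := univ)
      (t := univ ×ˢ Ico 0 1) h (by fun_prop) (fun x hx => ⟨mem_univ _, ht⟩)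
    exact continuousWithinAt_univ _ _ |>.1 this
  refine ⟨T, ?_, ?_, fun y t ht => (hTS y t ht).2, hTT⟩
  · rintro ⟨y, t⟩ ⟨-, ht⟩
    -- The same connectedness argument, now for continuity of `T` at `(y, t)`: between two levels of
    -- `I`, transport factors through the first level and is then given by a box.
    have key := isPreconnected_Ico.induction₂ (s := Ico (0 : ℝ) 1)
      (fun a b => ContinuousWithinAt T (univ ×ˢ Ico 0 1) (y, a) ↔
        ContinuousWithinAt T (univ ×ˢ Ico 0 1) (y, b)) (fun t₀ ht₀ => by
        obtain ⟨I, hIo, hI, hIb⟩ := hTcont t₀ ht₀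
        have step : ∀ a ∈ I ∩ Ico (0 : ℝ) 1, ∀ b ∈ I ∩ Ico (0 : ℝ) 1,
            ContinuousWithinAt T (univ ×ˢ Ico 0 1) (y, a) →
            ContinuousWithinAt T (univ ×ˢ Ico 0 1) (y, b) := by
          intro a ha b hb h
          refine hprop y a b ha.2 hb.2 (hslice y a ha.2 h) (hIb _ ?_ b hb)
          rw [(hTS y a ha.2).2]; exact ha.1
        filter_upwards [inter_mem_nhdsWithin (Ico (0 : ℝ) 1) (hIo.mem_nhds hI)] with b hb
        exact ⟨step _ ⟨hI, ht₀⟩ _ ⟨hb.2, hb.1⟩, step _ ⟨hb.2, hb.1⟩ _ ⟨hI, ht₀⟩⟩)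
      (fun _ _ _ _ _ _ h h' => h.trans h') (fun _ _ _ _ h => h.symm) (h01 y) ht
    obtain ⟨I, hIo, hI, hIb⟩ := hTcont (p y) (h01 y)
    exact key.1 (hIb y hI (p y) ⟨hI, h01 y⟩)
  · intro y
    have h := hTS y (p y) (h01 y)
    exact (huniq _ _ h.1 h.2.symm).symm

/-- Version of `exists_transport_of_relation` in which the relation is only known on `{p > 0}`. -/
theorem exists_transport_of_relation_pos {Y : Type*} [TopologicalSpace Y] [T2Space Y]
    {p : Y → ℝ} (hp : Continuous p) (h01 : ∀ y, p y ∈ Ico (0 : ℝ) 1)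
    (hK : ∀ c < 1, IsCompact (p ⁻¹' Icc 0 c)) (R : Y → Y → Prop)
    (hsymm : ∀ y z, R y z → R z y) (htrans : ∀ x y z, R x y → R y z → R x z)
    (huniq : ∀ y z, R y z → p y = p z → y = z)
    (hbox : ∀ y₀, ∃ N ∈ 𝓝 y₀, ∃ J : Set ℝ, IsOpen J ∧ p y₀ ∈ J ∧ ∃ τ : Y × ℝ → Y,
      ContinuousOn τ (N ×ˢ (J ∩ Ico 0 1)) ∧
      ∀ y ∈ N, p y ∈ J ∧ τ (y, p y) = y ∧ (∀ t ∈ J ∩ Ico 0 1, p (τ (y, t)) = t) ∧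
        ∀ t ∈ J ∩ Ico 0 1, ∀ t' ∈ J ∩ Ico 0 1, 0 < t → 0 < t' → R (τ (y, t)) (τ (y, t'))) :
    ∃ T : Y × ℝ → Y, ContinuousOn T (univ ×ˢ Ico 0 1) ∧
      (∀ y, T (y, p y) = y) ∧ (∀ y, ∀ t ∈ Ico (0 : ℝ) 1, p (T (y, t)) = t) ∧
      ∀ y, ∀ s ∈ Ico (0 : ℝ) 1, ∀ t ∈ Ico (0 : ℝ) 1, T (T (y, s), t) = T (y, t) := by
  classical
  choose N hN J hJo hJ τ hτc hτ using hbox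
  have hpos : ∀ z, p z = 0 → ∀ᶠ s in 𝓝[>] (0 : ℝ), 0 < s ∧ s ∈ J z ∩ Ico 0 1 := by
    intro z hz
    have h1 : J z ∈ 𝓝 (0 : ℝ) := (hJo z).mem_nhds (hz ▸ hJ z)
    filter_upwards [self_mem_nhdsWithin, nhdsWithin_le_nhds h1,
      nhdsWithin_le_nhds (Iio_mem_nhds one_pos)] with s h h' h''
    exact ⟨h, h', le_of_lt h, h''⟩
  -- continuity of a box along a curve
  have hlim : ∀ y₀, ∀ y ∈ N y₀, ∀ s ∈ J y₀ ∩ Ico 0 1, ∀ c : ℝ → Y,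
      Tendsto c (𝓝[>] 0) (𝓝 y) → (∀ᶠ s' in 𝓝[>] 0, c s' ∈ N y₀) →
      Tendsto (fun s' => τ y₀ (c s', s)) (𝓝[>] 0) (𝓝 (τ y₀ (y, s))) := by
    intro y₀ y hy s hs c hc hcN
    have h1 := hτc y₀ (y, s) ⟨hy, hs⟩
    refine h1.tendsto.comp (tendsto_nhdsWithin_iff.2 ⟨hc.prodMk_nhds tendsto_const_nhds, ?_⟩)
    filter_upwards [hcN] with s' hs'
    exact ⟨hs', hs⟩
  have hself : ∀ y₀, ∀ y ∈ N y₀, 0 ∈ J y₀ → 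
      Tendsto (fun s => τ y₀ (y, s)) (𝓝[>] 0) (𝓝 (τ y₀ (y, 0))) := by
    intro y₀ y hy h0
    have h1 := hτc y₀ (y, 0) ⟨hy, h0, le_rfl, one_pos⟩
    refine h1.tendsto.comp (tendsto_nhdsWithin_iff.2 
      ⟨tendsto_const_nhds.prodMk_nhds (tendsto_id.mono_left nhdsWithin_le_nhds), ?_⟩)
    filter_upwards [self_mem_nhdsWithin, nhdsWithin_le_nhds ((hJo y₀).mem_nhds h0),
      nhdsWithin_le_nhds (Iio_mem_nhds one_pos)] with s h h' h''
    exact ⟨hy, h', le_of_lt h, h''⟩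
  have hself0 : ∀ z, p z = 0 → Tendsto (fun s => τ z (z, s)) (𝓝[>] 0) (𝓝 z) := by
    intro z hz
    have := hself z z (mem_of_mem_nhds (hN z)) (hz ▸ hJ z)
    rwa [← hz, (hτ z z (mem_of_mem_nhds (hN z))).2.1, hz] at this
  -- curves inside a leaf converging to a boundary point
  have hcurve : ∀ z, p z = 0 → ∀ c : ℝ → Y, Tendsto c (𝓝[>] 0) (𝓝 z) →
      (∀ᶠ s in 𝓝[>] (0 : ℝ), p (c s) = s) →
      (∀ᶠ s in 𝓝[>] (0 : ℝ), ∀ᶠ s' in 𝓝[>] (0 : ℝ), R (c s) (c s')) →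
      ∀ᶠ s in 𝓝[>] (0 : ℝ), c s = τ z (z, s) := by
    intro z hz c hc hpc hR
    -- A boundary point determines its leaf. For small `s'` the box at `z` carries `c s'` to the
    -- point of its leaf on level `s`, which is `c s` by uniqueness; letting `s' → 0` gives `τ z (z,
    -- s)`.
    have hcN : ∀ᶠ s in 𝓝[>] (0 : ℝ), c s ∈ N z := hc (hN z)
    filter_upwards [hpc, hR, hpos z hz] with s hps hRs hs
    have h1 := hlim z z (mem_of_mem_nhds (hN z)) s hs.2 c hc hcN
    refine tendsto_nhds_unique (tendsto_const_nhds.congr' ?_) h1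
    filter_upwards [hcN, hRs, hpc, hpos z hz] with s' h2 h3 h4 h5
    obtain ⟨h6, h7, h8, h9⟩ := hτ z (c s') h2
    refine huniq _ _ (htrans _ _ _ h3 ?_) (by rw [hps, h8 s hs.2])
    have := h9 s' h5.2 s hs.2 h5.1 hs.1
    rw [h4] at h7
    rwa [h7] at this
  have hbase : ∀ z, ∃ t, p z = 0 → 0 < t ∧ t ∈ J z ∩ Ico 0 1 := by
    intro z
    by_cases hz : p z = 0
    · obtain ⟨t, ht⟩ := (hpos z hz).exists
      exact ⟨t, fun _ => ht⟩
    · exact ⟨0, fun h => absurd h hz⟩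
  choose b hb using hbase
  -- Points of level zero carry no relation of their own. Each is represented by a point of positive
  -- level on the curve leaving it, and the extended relation compares representatives.
  let ρ : Y → Y := fun z => if p z = 0 then τ z (z, b z) else z
  have hρ0 : ∀ z, p z = 0 → ρ z = τ z (z, b z) := fun z hz => if_pos hz
  have hρ1 : ∀ z, p z ≠ 0 → ρ z = z := fun z hz => if_neg hz
  have hρR : ∀ z, p z = 0 → ∀ s ∈ J z ∩ Ico 0 1, 0 < s → R (ρ z) (τ z (z, s)) := by
    intro z hz s hs hs0
    rw [hρ0 z hz]
    exact (hτ z z (mem_of_mem_nhds (hN z))).2.2.2 _ (hb z hz).2 s hs (hb z hz).1 hs0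
  have hmix : ∀ y₀, ∀ y ∈ N y₀, ∀ t ∈ J y₀ ∩ Ico 0 1, ∀ t' ∈ J y₀ ∩ Ico 0 1, 0 < t' →
      R (ρ (τ y₀ (y, t))) (τ y₀ (y, t')) := by
    intro y₀ y hy t ht t' ht' ht'0
    obtain ⟨h1, h2, h3, h4⟩ := hτ y₀ y hy
    rcases ht.2.1.eq_or_lt with rfl | ht0
    · have hz : p (τ y₀ (y, 0)) = 0 := h3 0 ht
      have hev : ∀ᶠ s in 𝓝[>] (0 : ℝ), 0 < s ∧ s ∈ J y₀ ∩ Ico 0 1 := by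
        filter_upwards [self_mem_nhdsWithin, nhdsWithin_le_nhds ((hJo y₀).mem_nhds ht.1),
          nhdsWithin_le_nhds (Iio_mem_nhds one_pos)] with s h h' h''
        exact ⟨h, h', le_of_lt h, h''⟩
      have hc := hcurve _ hz (fun s => τ y₀ (y, s)) (hself y₀ y hy ht.1)
        (hev.mono fun s hs => h3 s hs.2)
        (hev.mono fun s hs => hev.mono fun s' hs' => h4 s hs.2 s' hs'.2 hs.1 hs'.1)
      obtain ⟨s, hs, hs', hs''⟩ := (hc.and (hev.and (hpos _ hz))).exists
      refine htrans _ _ _ (hρR _ hz s hs''.2 hs''.1) ?_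
      rw [← hs]
      exact h4 s hs'.2 t' ht' hs'.1 ht'0
    · rw [hρ1 _ (by rw [h3 t ht]; exact ht0.ne')]
      exact h4 t ht t' ht' ht0 ht'0
  refine exists_transport_of_relation hp h01 hK (fun y z => R (ρ y) (ρ z))
    (fun _ _ h => hsymm _ _ h) (fun _ _ _ h h' => htrans _ _ _ h h') ?_ ?_
  · intro y z h hyz
    by_cases hy : p y = 0
    · have hz : p z = 0 := hyz ▸ hy
      -- The curves leaving `y` and `z` coincide on all small positive levels, so their limits `y`
      -- and `z` agree.
      refine tendsto_nhds_unique ((hself0 y hy).congr' ?_) (hself0 z hz)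
      filter_upwards [hpos y hy, hpos z hz] with s h1 h2
      refine huniq _ _ (htrans _ _ _ (hsymm _ _ (hρR y hy s h1.2 h1.1))
        (htrans _ _ _ h (hρR z hz s h2.2 h2.1))) ?_
      rw [(hτ y y (mem_of_mem_nhds (hN y))).2.2.1 s h1.2,
        (hτ z z (mem_of_mem_nhds (hN z))).2.2.1 s h2.2]
    · have hz : p z ≠ 0 := hyz ▸ hy
      simp only [hρ1 y hy, hρ1 z hz] at h
      exact huniq _ _ h hyz
  · intro y₀
    refine ⟨N y₀, hN y₀, J y₀, hJo y₀, hJ y₀, τ y₀, hτc y₀, fun y hy t ht =>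
      ⟨(hτ y₀ y hy).2.2.1 t ht, ?_⟩⟩
    -- Since `R` compares positive levels only, `y` and its transport are both compared with an
    -- auxiliary point on a positive level `s`.
    have hex : ∃ s ∈ J y₀ ∩ Ico (0 : ℝ) 1, 0 < s := by
      have h1 : ∀ᶠ s in 𝓝[>] (p y), s ∈ J y₀ :=
        nhdsWithin_le_nhds ((hJo y₀).mem_nhds (hτ y₀ y hy).1)
      have h2 : ∀ᶠ s in 𝓝[>] (p y), s < 1 := nhdsWithin_le_nhds (Iio_mem_nhds (h01 y).2)
      obtain ⟨s, h1, h2, h3⟩ := (h1.and (h2.and self_mem_nhdsWithin)).exists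
      have h4 : 0 < s := (h01 y).1.trans_lt h3
      exact ⟨s, ⟨h1, h4.le, h2⟩, h4⟩
    obtain ⟨s, hs, hs0⟩ := hex
    have h1 := hmix y₀ y hy (p y) ⟨(hτ y₀ y hy).1, h01 y⟩ s hs hs0
    rw [(hτ y₀ y hy).2.1] at h1
    exact htrans _ _ _ h1 (hsymm _ _ (hmix y₀ y hy t ht s hs hs0))

/-! ### Flow boxes parametrized by level -/

/-- Flow box for a `C¹` vector field `w` and a continuous function `g` which is strictly increasing
along the integral curves of `w`: nearby points can be moved along the flow to any nearby level
of `g`. -/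
theorem exists_flowBox {E : Type*} [NormedAddCommGroup E] [NormedSpace ℝ E] [CompleteSpace E]
    {w : E → E} {x₀ : E} (hw : ContDiffAt ℝ 1 w x₀) {W : Set E} (hW : W ∈ 𝓝 x₀) {g : E → ℝ}
    (hg : ContinuousOn g W)
    (hmono : ∀ (x : ℝ → E) (a b : ℝ), (∀ s ∈ Ioo a b, HasDerivAt x (w (x s)) s ∧ x s ∈ W) →
      StrictMonoOn (fun s => g (x s)) (Ioo a b)) :
    ∃ N ∈ 𝓝 x₀, ∃ J : Set ℝ, IsOpen J ∧ g x₀ ∈ J ∧ ∃ ε > 0, ∃ φ : E × ℝ → E, ∃ σ : E × ℝ → ℝ,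
      ContinuousOn φ (N ×ˢ Ioo (-ε) ε) ∧ ContinuousOn σ (N ×ˢ J) ∧
      ∀ x ∈ N, g x ∈ J ∧ φ (x, 0) = x ∧
        (∀ s ∈ Ioo (-ε) ε, HasDerivAt (fun s => φ (x, s)) (w (φ (x, s))) s ∧ φ (x, s) ∈ W) ∧
        ∀ t ∈ J, σ (x, t) ∈ Ioo (-ε) ε ∧ g (φ (x, σ (x, t))) = t := by
  obtain ⟨ε₀, hε₀, a, r, L, K, hr, hpl⟩ := IsPicardLindelof.of_contDiffAt_one hw
  obtain ⟨φ, hφ, hφc⟩ := (hpl 0).exists_forall_mem_closedBall_eq_hasDerivWithinAt_continuousOn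
  simp only [zero_sub, zero_add] at hφ hφc
  have hφ0 : φ (x₀, 0) = x₀ := (hφ x₀ (Metric.mem_closedBall_self r.2)).1
  have hr' : (0 : ℝ) < r := hr
  have hφat : ContinuousAt φ (x₀, 0) := hφc.continuousAt
    (prod_mem_nhds (Metric.closedBall_mem_nhds _ hr') (Icc_mem_nhds (by linarith) hε₀))
  have hφW : φ ⁻¹' W ∈ 𝓝 x₀ ×ˢ 𝓝 (0 : ℝ) := by
    rw [← nhds_prod_eq]; exact hφat.preimage_mem_nhds (by rwa [hφ0])
  obtain ⟨N₁, hN₁, I, hI, hNI⟩ := mem_prod_iff.1 hφW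
  obtain ⟨ε₁, hε₁, hI'⟩ := Metric.mem_nhds_iff.1 hI
  rw [Real.ball_eq_Ioo, zero_sub, zero_add] at hI'
  set ε := min ε₀ ε₁ with hε
  have hεpos : 0 < ε := lt_min hε₀ hε₁
  set N₂ := N₁ ∩ Metric.closedBall x₀ r ∩ W with hN₂
  have hN₂m : N₂ ∈ 𝓝 x₀ := inter_mem (inter_mem hN₁ (Metric.closedBall_mem_nhds _ hr')) hW
  have hder : ∀ x ∈ N₂, ∀ s ∈ Ioo (-ε) ε,
      HasDerivAt (fun s => φ (x, s)) (w (φ (x, s))) s ∧ φ (x, s) ∈ W := by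
    intro x hx s hs
    have h0 : ε ≤ ε₀ := min_le_left _ _
    have h1 : ε ≤ ε₁ := min_le_right _ _
    refine ⟨((hφ x hx.1.2).2 s ⟨by linarith [hs.1], by linarith [hs.2]⟩).hasDerivAt
      (Icc_mem_nhds (by linarith [hs.1]) (by linarith [hs.2])), ?_⟩
    exact hNI (⟨hx.1.1, hI' ⟨by linarith [hs.1], by linarith [hs.2]⟩⟩ : (x, s) ∈ N₁ ×ˢ I)
  have hc : ContinuousOn φ (N₂ ×ˢ Ioo (-ε) ε) := hφc.mono <| by
    have h0 : ε ≤ ε₀ := min_le_left _ _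
    rintro ⟨x, s⟩ ⟨hx, hs⟩
    exact ⟨hx.1.2, by linarith [hs.1], by linarith [hs.2]⟩
  have hgφ : ContinuousOn (fun z => g (φ z)) (N₂ ×ˢ Ioo (-ε) ε) :=
    hg.comp hc fun z hz => (hder z.1 hz.1 z.2 hz.2).2
  have hm : ∀ x ∈ N₂, StrictMonoOn (fun s => g (φ (x, s))) (Ioo (-ε) ε) :=
    fun x hx => hmono _ _ _ (hder x hx)
  have hx₀ : x₀ ∈ N₂ := mem_of_mem_nhds hN₂m
  -- Halving puts the closed interval `[-δ, δ]` inside the interval where the flow is controlled, as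
  -- the intermediate value theorem requires.
  set δ := ε / 2 with hδ
  have hδm : δ ∈ Ioo (-ε) ε := ⟨by linarith, by linarith⟩
  have hδm' : -δ ∈ Ioo (-ε) ε := ⟨by linarith, by linarith⟩
  have h0m : (0 : ℝ) ∈ Ioo (-ε) ε := ⟨by linarith, by linarith⟩
  have hlo : g (φ (x₀, -δ)) < g x₀ := by
    have := hm x₀ hx₀ hδm' h0m (by linarith)
    simpa [hφ0] using this
  have hhi : g x₀ < g (φ (x₀, δ)) := by
    have := hm x₀ hx₀ h0m hδm (by linarith)
    simpa [hφ0] using this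
  obtain ⟨t₁, ht₁, ht₁'⟩ := exists_between hlo
  obtain ⟨t₂, ht₂, ht₂'⟩ := exists_between hhi
  have hsl : ∀ s ∈ Ioo (-ε) ε, ContinuousAt (fun x => g (φ (x, s))) x₀ := by
    intro s hs
    have h1 : ContinuousOn (fun x => g (φ (x, s))) N₂ :=
      hgφ.comp (f := fun x : E => (x, s)) (by fun_prop) fun x hx => ⟨hx, hs⟩
    exact h1.continuousAt hN₂m
  have hev : ∀ᶠ x in 𝓝 x₀, x ∈ N₂ ∧ g (φ (x, -δ)) < t₁ ∧ t₂ < g (φ (x, δ)) ∧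
      g x ∈ Ioo t₁ t₂ := by
    filter_upwards [hN₂m, (hsl _ hδm').eventually (Iio_mem_nhds ht₁),
      (hsl _ hδm).eventually (Ioi_mem_nhds ht₂'),
      (hg.continuousAt hW).eventually (Ioo_mem_nhds ht₁' ht₂)] with x h1 h2 h3 h4
    exact ⟨h1, h2, h3, h4⟩
  -- `σ (x, t)` is the time at which the orbit of `x` reaches level `t`. Stating the conditions as
  -- implications makes `σ` a total function.
  have hsol : ∀ z : E × ℝ, ∃ s, (z.1 ∈ N₂ ∧ g (φ (z.1, -δ)) < t₁ ∧ t₂ < g (φ (z.1, δ)) ∧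
      g z.1 ∈ Ioo t₁ t₂) → z.2 ∈ Ioo t₁ t₂ → s ∈ Ioo (-δ) δ ∧ g (φ (z.1, s)) = z.2 := by
    rintro ⟨x, t⟩
    by_cases h : (x ∈ N₂ ∧ g (φ (x, -δ)) < t₁ ∧ t₂ < g (φ (x, δ)) ∧ g x ∈ Ioo t₁ t₂) ∧
      t ∈ Ioo t₁ t₂
    · obtain ⟨⟨h1, h2, h3, -⟩, ht⟩ := h
      have hcs : ContinuousOn (fun s => g (φ (x, s))) (Icc (-δ) δ) :=
        hgφ.comp (f := fun s : ℝ => (x, s)) (by fun_prop) fun s hs =>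
          ⟨h1, by linarith [hs.1], by linarith [hs.2]⟩
      obtain ⟨s, hs, hst⟩ := intermediate_value_Ioo (by linarith) hcs
        (⟨h2.trans ht.1, ht.2.trans h3⟩ : t ∈ Ioo _ _)
      exact ⟨s, fun _ _ => ⟨hs, hst⟩⟩
    · exact ⟨0, fun h1 h2 => absurd ⟨h1, h2⟩ h⟩
  choose σ hσ using hsol
  set N := {x | x ∈ N₂ ∧ g (φ (x, -δ)) < t₁ ∧ t₂ < g (φ (x, δ)) ∧ g x ∈ Ioo t₁ t₂} with hN
  have hNN : N ⊆ N₂ := fun x hx => hx.1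
  have hsub : Ioo (-δ) δ ⊆ Ioo (-ε) ε := Ioo_subset_Ioo (by linarith) (by linarith)
  refine ⟨N, hev, Ioo t₁ t₂, isOpen_Ioo, ⟨ht₁', ht₂⟩, ε, hεpos, φ, σ,
    hc.mono (prod_mono hNN le_rfl), ?_, fun x hx => ⟨hx.2.2.2, (hφ x hx.1.1.2).1,
    hder x (hNN hx), fun t ht => ⟨hsub (hσ (x, t) hx ht).1, (hσ (x, t) hx ht).2⟩⟩⟩
  rintro ⟨x, t⟩ ⟨hx, ht⟩
  obtain ⟨h1, h2⟩ := hσ (x, t) hx ht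
  have hcont : ∀ s ∈ Ioo (-ε) ε, ContinuousWithinAt (fun z : E × ℝ => z.2 - g (φ (z.1, s)))
      (N ×ˢ Ioo t₁ t₂) (x, t) := by
    intro s hs
    have h3 : ContinuousOn (fun z : E × ℝ => z.2 - g (φ (z.1, s))) (N ×ˢ Ioo t₁ t₂) :=
      continuousOn_snd.sub (hgφ.comp (f := fun z : E × ℝ => (z.1, s)) (by fun_prop)
        fun z hz => ⟨hNN hz.1, hs⟩)
    exact h3 _ ⟨hx, ht⟩
  -- Since `g` is merely continuous, the implicit function theorem is replaced by monotonicity: `a <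
  -- σ (x, t)` amounts to `g (φ (x, a)) < t`, which is an open condition on `(x, t)`; likewise for
  -- upper bounds.
  refine tendsto_order.2 ⟨fun a ha => ?_, fun b hb => ?_⟩
  · by_cases haδ : a ≤ -δ
    · filter_upwards [self_mem_nhdsWithin] with z hz
      exact haδ.trans_lt (hσ z hz.1 hz.2).1.1
    · have ham : a ∈ Ioo (-ε) ε := ⟨by linarith, by linarith [h1.2]⟩
      have h3 : 0 < t - g (φ (x, a)) := by
        have := hm x (hNN hx) ham (hsub h1) ha
        simp only [h2] at this; linarith
      filter_upwards [self_mem_nhdsWithin, (hcont a ham).eventually (Ioi_mem_nhds h3)] with z hz h4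
      obtain ⟨h5, h6⟩ := hσ z hz.1 hz.2
      refine ((hm z.1 (hNN hz.1)).lt_iff_lt ham (hsub h5)).1 ?_
      change g (φ (z.1, a)) < g (φ (z.1, σ z))
      rw [h6]; exact sub_pos.1 h4
  · by_cases hbδ : δ ≤ b
    · filter_upwards [self_mem_nhdsWithin] with z hz
      exact (hσ z hz.1 hz.2).1.2.trans_le hbδ
    · have hbm : b ∈ Ioo (-ε) ε := ⟨by linarith [h1.1], by linarith⟩
      have h3 : t - g (φ (x, b)) < 0 := by
        have := hm x (hNN hx) (hsub h1) hbm hb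
        simp only [h2] at this; linarith
      filter_upwards [self_mem_nhdsWithin, (hcont b hbm).eventually (Iio_mem_nhds h3)] with z hz h4
      obtain ⟨h5, h6⟩ := hσ z hz.1 hz.2
      refine ((hm z.1 (hNN hz.1)).lt_iff_lt (hsub h5) hbm).1 ?_
      change g (φ (z.1, σ z)) < g (φ (z.1, b))
      rw [h6]; exact sub_neg.1 h4

/-! ### Extending the product of coordinates beyond the orthant -/

/-- The product of the coordinates on the closed positive orthant, extended continuously by the
(negative) minimum of the coordinates outside it. -/
noncomputable def extendedProd {ι : Type*} [Fintype ι] [Nonempty ι] (f : ι → ℝ) : ℝ :=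
  ∏ i, max (f i) 0 + min 0 (Finset.univ.inf' Finset.univ_nonempty f)

section extendedProd

variable {ι : Type*} [Fintype ι] [Nonempty ι]

theorem continuous_extendedProd : Continuous (extendedProd : (ι → ℝ) → ℝ) := by
  unfold extendedProd
  refine (continuous_finsetProd _ fun i _ => (continuous_apply i).max continuous_const).add ?_
  exact continuous_const.min (Continuous.finset_inf'_apply _ fun i _ => continuous_apply i)

theorem extendedProd_of_nonneg {f : ι → ℝ} (hf : ∀ i, 0 ≤ f i) : extendedProd f = ∏ i, f i := by
  have h : 0 ≤ Finset.univ.inf' Finset.univ_nonempty f :=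
    (Finset.le_inf'_iff _ _).2 fun i _ => hf i
  rw [extendedProd, min_eq_left h, add_zero]
  exact Finset.prod_congr rfl fun i _ => max_eq_left (hf i)

theorem extendedProd_of_neg {f : ι → ℝ} {i : ι} (hi : f i < 0) :
    extendedProd f = Finset.univ.inf' Finset.univ_nonempty f := by
  have h : Finset.univ.inf' Finset.univ_nonempty f ≤ 0 :=
    (Finset.inf'_le _ (Finset.mem_univ i)).trans hi.le
  rw [extendedProd, min_eq_right h, Finset.prod_eq_zero (Finset.mem_univ i) (max_eq_right hi.le),
    zero_add]

theorem extendedProd_neg_of_neg {f : ι → ℝ} {i : ι} (hi : f i < 0) : extendedProd f < 0 := by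
  rw [extendedProd_of_neg hi]
  exact (Finset.inf'_le _ (Finset.mem_univ i)).trans_lt hi

theorem extendedProd_nonneg_iff {f : ι → ℝ} : 0 ≤ extendedProd f ↔ ∀ i, 0 ≤ f i := by
  refine ⟨fun h i => ?_, fun h => ?_⟩
  · by_contra! hi
    exact h.not_gt (extendedProd_neg_of_neg hi)
  · rw [extendedProd_of_nonneg h]; exact Finset.prod_nonneg fun i _ => h i

theorem extendedProd_pos_iff {f : ι → ℝ} : 0 < extendedProd f ↔ ∀ i, 0 < f i := by
  refine ⟨fun h i => ?_, fun h => ?_⟩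
  · have h0 := extendedProd_nonneg_iff.1 h.le
    refine (h0 i).lt_of_ne fun hi => ?_
    rw [extendedProd_of_nonneg h0, Finset.prod_eq_zero (Finset.mem_univ i) hi.symm] at h
    exact h.false
  · rw [extendedProd_of_nonneg fun i => (h i).le]; exact Finset.prod_pos fun i _ => h i

/-- The minimum is used because the bare product is not monotone outside the orthant, where flow
lines of the extended field also run. With both arguments in the orthant, products are compared, a
vanishing coordinate being treated apart; with only the larger one inside, signs decide; otherwise
minima are compared. -/
theorem extendedProd_lt {f f' : ι → ℝ} (h : ∀ i, f i < f' i) : extendedProd f < extendedProd f' := by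
  by_cases hf' : ∀ i, 0 ≤ f' i
  · by_cases hf : ∀ i, 0 ≤ f i
    · rw [extendedProd_of_nonneg hf, extendedProd_of_nonneg hf']
      by_cases h0 : ∃ i, f i = 0
      · obtain ⟨i, hi⟩ := h0
        rw [Finset.prod_eq_zero (Finset.mem_univ i) hi]
        exact Finset.prod_pos fun j _ => (hf j).trans_lt (h j)
      · push Not at h0
        exact Finset.prod_lt_prod_of_nonempty (fun i _ => (hf i).lt_of_ne' (h0 i))
          (fun i _ => h i) Finset.univ_nonempty
    · push Not at hf
      obtain ⟨i, hi⟩ := hf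
      exact (extendedProd_neg_of_neg hi).trans_le (extendedProd_nonneg_iff.2 hf')
  · push Not at hf'
    obtain ⟨i, hi⟩ := hf'
    rw [extendedProd_of_neg hi, extendedProd_of_neg ((h i).trans hi), Finset.lt_inf'_iff]
    exact fun j _ => (Finset.inf'_le _ (Finset.mem_univ j)).trans_lt (h j)

end extendedProd

/-! ### Germs of orthants in normal crossing charts -/

/-- The vector whose first `k` coordinates are the signs `ε` and whose other coordinates vanish. -/
noncomputable def signVector {n k : ℕ} (ε : Fin k → ℤˣ) : EuclideanSpace ℝ (Fin n) :=
  WithLp.toLp 2 fun l => if h : (l : ℕ) < k then ((ε ⟨l, h⟩ : ℤ) : ℝ) else 0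

theorem signVector_castLE {n k : ℕ} (hk : k ≤ n) (ε : Fin k → ℤˣ) (i : Fin k) :
    (signVector ε : EuclideanSpace ℝ (Fin n)) (Fin.castLE hk i) = ((ε i : ℤ) : ℝ) := by
  simp [signVector]

theorem units_mul_self_cast (u : ℤˣ) : ((u : ℤ) : ℝ) * ((u : ℤ) : ℝ) = 1 := by
  rcases Int.units_eq_one_or u with rfl | rfl <;> simp

namespace NormalCrossingChart

variable {n : ℕ} {X : Type*} [TopologicalSpace X] [ChartedSpace (EuclideanSpace ℝ (Fin n)) X]
  {D : Set X} (c : NormalCrossingChart n D)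

/-- The `i`-th of the first `k` coordinates. -/
def coord (i : Fin c.k) (q : X) : ℝ := c.chart q (Fin.castLE c.k_le i)

theorem continuousOn_coord (i : Fin c.k) : ContinuousOn (c.coord i) c.chart.source :=
  (EuclideanSpace.proj (𝕜 := ℝ) (Fin.castLE c.k_le i)).continuous.comp_continuousOn
    c.chart.continuousOn

theorem continuousAt_coord (i : Fin c.k) {q : X} (hq : q ∈ c.chart.source) :
    ContinuousAt (c.coord i) q :=
  (c.continuousOn_coord i).continuousAt (c.chart.open_source.mem_nhds hq)

theorem isOpen_openOrthant (ε : Fin c.k → ℤˣ) : IsOpen (c.openOrthant ε) := by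
  rw [isOpen_iff_mem_nhds]
  rintro q ⟨hq, hε⟩
  have h : ∀ᶠ z in 𝓝 q, ∀ i, 0 < ((ε i : ℤ) : ℝ) * c.coord i z := eventually_all.2 fun i =>
    (continuousAt_const.mul (c.continuousAt_coord i hq)).eventually (Ioi_mem_nhds (hε i))
  filter_upwards [c.chart.open_source.mem_nhds hq, h] with z h1 h2 using ⟨h1, h2⟩

/-- The signs of the first `k` coordinates. -/
noncomputable def signs (q : X) (i : Fin c.k) : ℤˣ := if 0 ≤ c.coord i q then 1 else -1

theorem notMem_of_mem_openOrthant {ε : Fin c.k → ℤˣ} {q : X} (hq : q ∈ c.openOrthant ε) :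
    q ∉ D := by
  rw [c.mem_iff q hq.1, Finset.prod_eq_zero_iff]
  rintro ⟨i, -, hi⟩
  have := hq.2 i
  rw [hi, mul_zero] at this
  exact this.false

theorem mem_openOrthant_signs {q : X} (hq : q ∈ c.chart.source) (hD : q ∉ D) :
    q ∈ c.openOrthant (c.signs q) := by
  refine ⟨hq, fun i => ?_⟩
  rw [c.mem_iff q hq, Finset.prod_eq_zero_iff] at hD
  push Not at hD
  have h := hD i (Finset.mem_univ i)
  change 0 < ((c.signs q i : ℤ) : ℝ) * c.coord i q
  change c.coord i q ≠ 0 at h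
  unfold signs
  split_ifs with h0
  · simpa using h0.lt_of_ne' h
  · simpa using h0

theorem signs_eq {ε : Fin c.k → ℤˣ} {q : X} (hq : q ∈ c.openOrthant ε) : c.signs q = ε := by
  funext i
  have h : 0 < ((ε i : ℤ) : ℝ) * c.coord i q := hq.2 i
  unfold signs
  rcases Int.units_eq_one_or (ε i) with h1 | h1 <;> rw [h1] at h ⊢ <;> simp at h
  · rw [if_pos h.le]
  · rw [if_neg h.not_ge]

theorem openOrthant_subset_closedOrthant (ε : Fin c.k → ℤˣ) :
    c.openOrthant ε ⊆ c.closedOrthant ε := fun _ h => ⟨h.1, fun i => (h.2 i).le⟩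

theorem tendsto_chart_symm_add_smul {q : X} (hq : q ∈ c.chart.source)
    (u : EuclideanSpace ℝ (Fin n)) :
    Tendsto (fun s : ℝ => c.chart.symm (c.chart q + s • u)) (𝓝[>] 0) (𝓝 q) := by
  have h1 : Tendsto (fun s : ℝ => c.chart q + s • u) (𝓝 0) (𝓝 (c.chart q)) := by
    have : Continuous fun s : ℝ => c.chart q + s • u := by fun_prop
    simpa using this.tendsto 0
  have h2 := (c.chart.continuousAt_symm (c.chart.map_source hq)).tendsto
  rw [c.chart.left_inv hq] at h2
  exact (h2.comp h1).mono_left nhdsWithin_le_nhds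

/-- Directions which point strictly into the orthant `ε` lead from any point of the closed orthant
into the open orthant. -/
theorem eventually_mem_openOrthant {ε : Fin c.k → ℤˣ} {q : X} (hq : q ∈ c.closedOrthant ε)
    {u : EuclideanSpace ℝ (Fin n)}
    (hu : ∀ i, 0 < ((ε i : ℤ) : ℝ) * u (Fin.castLE c.k_le i)) :
    ∀ᶠ s in 𝓝[>] (0 : ℝ), c.chart.symm (c.chart q + s • u) ∈ c.openOrthant ε := by
  have h1 : Tendsto (fun s : ℝ => c.chart q + s • u) (𝓝 0) (𝓝 (c.chart q)) := by
    have : Continuous fun s : ℝ => c.chart q + s • u := by fun_prop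
    simpa using this.tendsto 0
  filter_upwards [self_mem_nhdsWithin, nhdsWithin_le_nhds
    (h1 (c.chart.open_target.mem_nhds (c.chart.map_source hq.1)))] with s hs hs'
  refine ⟨c.chart.map_target hs', fun i => ?_⟩
  rw [c.chart.right_inv hs']
  have h2 := hq.2 i
  have h3 : 0 < s * (((ε i : ℤ) : ℝ) * u (Fin.castLE c.k_le i)) := mul_pos hs (hu i)
  simp only [PiLp.add_apply, PiLp.smul_apply, smul_eq_mul]
  nlinarith

theorem signVector_inward (ε : Fin c.k → ℤˣ) (i : Fin c.k) :
    0 < ((ε i : ℤ) : ℝ) * (signVector ε : EuclideanSpace ℝ (Fin n)) (Fin.castLE c.k_le i) := by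
  rw [signVector_castLE, units_mul_self_cast]; exact one_pos

/-- Moving from `q` along the sign vector enters the open orthant at once, so the germ of an orthant
along its closure is never empty. -/
theorem neBot_nhdsWithin_openOrthant {ε : Fin c.k → ℤˣ} {q : X} (hq : q ∈ c.closedOrthant ε) :
    (𝓝[c.openOrthant ε] q).NeBot :=
  (tendsto_nhdsWithin_iff.2 ⟨c.tendsto_chart_symm_add_smul hq.1 _,
    c.eventually_mem_openOrthant hq (c.signVector_inward ε)⟩).neBot

theorem mem_closedOrthant_of_neBot {α : Type*} {l : Filter α} [l.NeBot] {ε : Fin c.k → ℤˣ}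
    {f : α → X} {q : X} (hq : q ∈ c.chart.source) (hf : Tendsto f l (𝓝 q))
    (hl : ∀ᶠ a in l, f a ∈ c.closedOrthant ε) : q ∈ c.closedOrthant ε := by
  refine ⟨hq, fun i => ?_⟩
  refine ge_of_tendsto ((tendsto_const_nhds (x := ((ε i : ℤ) : ℝ))).mul
    ((c.continuousAt_coord i hq).tendsto.comp hf)) ?_
  filter_upwards [hl] with a ha using ha.2 i

theorem mem_closedOrthant_of_neBot_nhdsWithin {ε : Fin c.k → ℤˣ} {q : X}
    (hq : q ∈ c.chart.source) [(𝓝[c.openOrthant ε] q).NeBot] : q ∈ c.closedOrthant ε :=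
  c.mem_closedOrthant_of_neBot hq (tendsto_id.mono_left nhdsWithin_le_nhds)
    (eventually_mem_nhdsWithin.mono fun _ h => c.openOrthant_subset_closedOrthant ε h)

/-- Open orthants are locally connected along their closure. -/
theorem exists_isPreconnected_inter (ε : Fin c.k → ℤˣ) {q : X} (hq : q ∈ c.chart.source)
    {U : Set X} (hU : U ∈ 𝓝 q) :
    ∃ N ∈ 𝓝 q, N ⊆ U ∧ IsPreconnected (c.openOrthant ε ∩ N) := by
  have h1 : c.chart.symm ⁻¹' U ∩ c.chart.target ∈ 𝓝 (c.chart q) :=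
    inter_mem ((c.chart.continuousAt_symm (c.chart.map_source hq)).preimage_mem_nhds
      (by rwa [c.chart.left_inv hq])) (c.chart.open_target.mem_nhds (c.chart.map_source hq))
  obtain ⟨r, hr, hrU⟩ := Metric.mem_nhds_iff.1 h1
  refine ⟨c.chart.source ∩ c.chart ⁻¹' Metric.ball (c.chart q) r, ?_, ?_, ?_⟩
  · exact inter_mem (c.chart.open_source.mem_nhds hq)
      ((c.chart.continuousAt hq).preimage_mem_nhds (Metric.ball_mem_nhds _ hr))
  · rintro z ⟨hz, hz'⟩
    have := (hrU hz').1
    rwa [mem_preimage, c.chart.left_inv hz] at this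
  -- In the chart, a ball intersected with half-spaces is convex, hence connected.
  · let A : Set (EuclideanSpace ℝ (Fin n)) :=
      Metric.ball (c.chart q) r ∩
        ⋂ i : Fin c.k, {x | 0 < ((ε i : ℤ) : ℝ) * x (Fin.castLE c.k_le i)}
    have hA : Convex ℝ A := by
      refine (convex_ball _ _).inter (convex_iInter fun i => ?_)
      exact convex_halfSpace_gt
        (((ε i : ℤ) : ℝ) • (EuclideanSpace.proj (𝕜 := ℝ) (Fin.castLE c.k_le i))).isLinear _
    have himg : c.openOrthant ε ∩ (c.chart.source ∩ c.chart ⁻¹' Metric.ball (c.chart q) r) =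
        c.chart.symm '' A := by
      ext z
      constructor
      · rintro ⟨hz, hz', hb⟩
        exact ⟨c.chart z, ⟨hb, mem_iInter.2 hz.2⟩, c.chart.left_inv hz'⟩
      · rintro ⟨x, ⟨hx, hx'⟩, rfl⟩
        have ht := (hrU hx).2
        have hs := c.chart.map_target ht
        refine ⟨⟨hs, fun i => ?_⟩, hs, ?_⟩
        · rw [c.chart.right_inv ht]; exact mem_iInter.1 hx' i
        · rw [mem_preimage, c.chart.right_inv ht]; exact hx
    rw [himg]
    exact hA.isPreconnected.image _
      (c.chart.continuousOn_symm.mono fun x hx => (hrU hx.1).2)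

/-- By local connectedness of the orthant at `q`, a separation of its germ into two open parts must
be trivial. This serves both for comparing charts and for the sign of `π`. -/
theorem eventually_mem_of_isOpen_cover {ε : Fin c.k → ℤˣ} {q : X} (hq : q ∈ c.closedOrthant ε)
    {U A B : Set X} (hU : U ∈ 𝓝 q) (hA : IsOpen A) (hB : IsOpen B) (hAB : Disjoint A B)
    (hcov : c.openOrthant ε ∩ U ⊆ A ∪ B) (hfreq : ∃ᶠ z in 𝓝[c.openOrthant ε] q, z ∈ A) :
    ∀ᶠ z in 𝓝[c.openOrthant ε] q, z ∈ A := by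
  obtain ⟨N, hN, hNU, hconn⟩ := c.exists_isPreconnected_inter ε hq.1 hU
  have hmem : c.openOrthant ε ∩ N ∈ 𝓝[c.openOrthant ε] q := inter_mem_nhdsWithin _ hN
  obtain ⟨z, hzA, hz⟩ := (hfreq.and_eventually hmem).exists
  exact mem_of_superset hmem (hconn.subset_left_of_subset_union hA hB hAB
    ((inter_subset_inter_right _ hNU).trans hcov) ⟨z, hz, hzA⟩)

theorem disjoint_openOrthant {ε ε' : Fin c.k → ℤˣ} (h : ε ≠ ε') :
    Disjoint (c.openOrthant ε) (c.openOrthant ε') :=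
  disjoint_left.2 fun _ h1 h2 => h ((c.signs_eq h1).symm.trans (c.signs_eq h2))

/-- Near `q` the complement of `D` is the disjoint union of the finitely many open orthants of `c'`.
One of them is met arbitrarily close to `q`, and connectedness then forces the whole germ into it.
-/
theorem exists_nhdsWithin_le (c' : NormalCrossingChart n D) {ε : Fin c.k → ℤˣ} {q : X}
    (hq : q ∈ c.closedOrthant ε) (hq' : q ∈ c'.chart.source) :
    ∃ ε', 𝓝[c.openOrthant ε] q ≤ 𝓝[c'.openOrthant ε'] q := by
  have := c.neBot_nhdsWithin_openOrthant hq
  have hU := c'.chart.open_source.mem_nhds hq'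
  have h1 : ∃ᶠ z in 𝓝[c.openOrthant ε] q, ∃ ε', z ∈ c'.openOrthant ε' := by
    refine Eventually.frequently ?_
    filter_upwards [self_mem_nhdsWithin, nhdsWithin_le_nhds hU] with z hz hz'
    exact ⟨_, c'.mem_openOrthant_signs hz' (c.notMem_of_mem_openOrthant hz)⟩
  obtain ⟨ε', hε'⟩ := frequently_exists.1 h1
  refine ⟨ε', le_inf nhdsWithin_le_nhds (le_principal_iff.2 ?_)⟩
  refine c.eventually_mem_of_isOpen_cover hq hU (c'.isOpen_openOrthant ε')
    (B := ⋃ δ : {δ // δ ≠ ε'}, c'.openOrthant δ) (isOpen_iUnion fun δ => c'.isOpen_openOrthant _)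
    (disjoint_iUnion_right.2 fun δ => c'.disjoint_openOrthant δ.2.symm) ?_ hε'
  rintro z ⟨hz, hz'⟩
  have h2 := c'.mem_openOrthant_signs hz' (c.notMem_of_mem_openOrthant hz)
  by_cases h : c'.signs z = ε'
  · exact Or.inl (h ▸ h2)
  · exact Or.inr (mem_iUnion.2 ⟨⟨_, h⟩, h2⟩)

/-- The germ of an orthant of one chart is the germ of an orthant of any other chart. -/
theorem exists_nhdsWithin_eq (c' : NormalCrossingChart n D) {ε : Fin c.k → ℤˣ} {q : X}
    (hq : q ∈ c.closedOrthant ε) (hq' : q ∈ c'.chart.source) :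
    ∃ ε', q ∈ c'.closedOrthant ε' ∧ 𝓝[c.openOrthant ε] q = 𝓝[c'.openOrthant ε'] q := by
  have := c.neBot_nhdsWithin_openOrthant hq
  obtain ⟨ε', h⟩ := c.exists_nhdsWithin_le c' hq hq'
  have := NeBot.mono ‹_› h
  have hmem : q ∈ c'.closedOrthant ε' := c'.mem_closedOrthant_of_neBot_nhdsWithin hq'
  -- Comparing back puts the germ of `ε` into that of `δ` in the same chart. Distinct orthants of
  -- one chart are disjoint and the germ is nonempty, so `δ = ε` and both inclusions are equalities.
  obtain ⟨δ, hδ⟩ := c'.exists_nhdsWithin_le c hmem hq.1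
  have hεδ : ε = δ := by
    have h1 : ∀ᶠ z in 𝓝[c.openOrthant ε] q, z ∈ c.openOrthant δ := h.trans hδ self_mem_nhdsWithin
    obtain ⟨z, hz, hz'⟩ := (h1.and self_mem_nhdsWithin).exists
    exact (c.signs_eq hz').symm.trans (c.signs_eq hz)
  subst hεδ
  exact ⟨ε', hmem, le_antisymm h hδ⟩

end NormalCrossingChart

/-! ### Topology of the real-oriented blow-up -/

namespace RealOrientedBlowup

variable {n : ℕ} {X : Type*} [TopologicalSpace X] [ChartedSpace (EuclideanSpace ℝ (Fin n)) X]
  {D : Set X}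

/-- The inclusion of a closed orthant into the real-oriented blow-up. -/
def orthantMap (c : NormalCrossingChart n D) (ε : Fin c.k → ℤˣ) (q : c.closedOrthant ε) :
    RealOrientedBlowup n D :=
  Quotient.mk (blowupSetoid n D) ⟨c, ε, q⟩

/-- The local side of `D` at a point of the blow-up. -/
def side (y : RealOrientedBlowup n D) : Filter X :=
  Quotient.lift BlowupPieces.side (fun _ _ h => And.right h) y

theorem ext_iff {y y' : RealOrientedBlowup n D} :
    y = y' ↔ y.blowDown = y'.blowDown ∧ y.side = y'.side := by
  induction y using Quotient.inductionOn
  induction y' using Quotient.inductionOn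
  exact Quotient.eq

theorem isOpen_iff {s : Set (RealOrientedBlowup n D)} :
    IsOpen s ↔ ∀ c ε, IsOpen (orthantMap c ε ⁻¹' s) := by
  have h1 : IsOpen s ↔ IsOpen (Quotient.mk (blowupSetoid n D) ⁻¹' s) := Iff.rfl
  rw [h1, isOpen_sigma_iff]
  exact forall_congr' fun c => isOpen_sigma_iff

theorem continuous_orthantMap (c : NormalCrossingChart n D) (ε : Fin c.k → ℤˣ) :
    Continuous (orthantMap c ε) :=
  ⟨fun _ hs => isOpen_iff.1 hs c ε⟩

theorem continuous_blowDown : Continuous (blowDown : RealOrientedBlowup n D → X) :=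
  ⟨fun _ hs => isOpen_iff.2 fun _ _ => hs.preimage continuous_subtype_val⟩

theorem exists_orthantMap (y : RealOrientedBlowup n D) :
    ∃ c ε, ∃ q : c.closedOrthant ε, orthantMap c ε q = y := by
  induction y using Quotient.inductionOn with
  | h x => exact ⟨x.1, x.2.1, x.2.2, rfl⟩

theorem side_neBot (y : RealOrientedBlowup n D) : y.side.NeBot := by
  obtain ⟨c, ε, q, rfl⟩ := y.exists_orthantMap
  exact c.neBot_nhdsWithin_openOrthant q.2

theorem exists_orthantMap_eq (y : RealOrientedBlowup n D) (c : NormalCrossingChart n D)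
    (hc : y.blowDown ∈ c.chart.source) : ∃ ε, ∃ q : c.closedOrthant ε, orthantMap c ε q = y := by
  obtain ⟨c₀, ε₀, q₀, rfl⟩ := y.exists_orthantMap
  obtain ⟨ε, hq, h⟩ := c₀.exists_nhdsWithin_eq c q₀.2 hc
  exact ⟨ε, ⟨q₀, hq⟩, ext_iff.2 ⟨rfl, h.symm⟩⟩

/-- Two orthants with the same germ at `q` coincide as sets in a neighbourhood of `q`, so they have
the same germ at every nearby point: the gluing relation is open. -/
theorem isOpen_range_orthantMap (c : NormalCrossingChart n D) (ε : Fin c.k → ℤˣ) :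
    IsOpen (range (orthantMap c ε)) := by
  refine isOpen_iff.2 fun c' ε' => isOpen_iff_mem_nhds.2 ?_
  rintro ⟨q, hq'⟩ ⟨q₀, h⟩
  obtain ⟨h1, h2⟩ := ext_iff.1 h
  change (q₀ : X) = q at h1
  change 𝓝[c.openOrthant ε] (q₀ : X) = 𝓝[c'.openOrthant ε'] q at h2
  rw [h1, nhdsWithin_eq_iff_eventuallyEq] at h2
  have hsrc : ∀ᶠ z in 𝓝 q, z ∈ c.chart.source := c.chart.open_source.mem_nhds (h1 ▸ q₀.2.1)
  have key : ∀ᶠ z in 𝓝 q, z ∈ c'.closedOrthant ε' → ∃ hz : z ∈ c.closedOrthant ε,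
      𝓝[c.openOrthant ε] z = 𝓝[c'.openOrthant ε'] z := by
    filter_upwards [eventually_eventuallyEq_nhds.2 h2, hsrc] with z hz hzs hz'
    have h3 := nhdsWithin_eq_iff_eventuallyEq.2 hz
    have := c'.neBot_nhdsWithin_openOrthant hz'
    rw [← h3] at this
    exact ⟨c.mem_closedOrthant_of_neBot_nhdsWithin hzs, h3⟩
  filter_upwards [continuous_subtype_val.continuousAt.eventually key] with z hz
  obtain ⟨hz1, hz2⟩ := hz z.2
  exact ⟨⟨z, hz1⟩, ext_iff.2 ⟨rfl, hz2⟩⟩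

theorem disjoint_range_orthantMap (c : NormalCrossingChart n D) {ε ε' : Fin c.k → ℤˣ}
    (h : ε ≠ ε') : Disjoint (range (orthantMap c ε)) (range (orthantMap c ε')) := by
  refine disjoint_left.2 ?_
  rintro _ ⟨q, rfl⟩ ⟨q', hq⟩
  obtain ⟨h1, h2⟩ := ext_iff.1 hq
  have := c.neBot_nhdsWithin_openOrthant q.2
  have h3 : ∀ᶠ z in 𝓝[c.openOrthant ε] (q : X), z ∈ c.openOrthant ε' := by
    change 𝓝[c.openOrthant ε'] (q' : X) = 𝓝[c.openOrthant ε] (q : X) at h2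
    rw [← h2]; exact self_mem_nhdsWithin
  obtain ⟨z, hz, hz'⟩ := (h3.and self_mem_nhdsWithin).exists
  exact disjoint_left.1 (c.disjoint_openOrthant h) hz' hz

/-- Distinct points over the same point of `X` lie in different orthants of one chart, whose images
are open and disjoint. All other pairs are separated in `X`. -/
instance [T2Space X] : T2Space (RealOrientedBlowup n D) := by
  refine ⟨fun y y' hne => ?_⟩
  by_cases h : y.blowDown = y'.blowDown
  · obtain ⟨c, ε, q, rfl⟩ := y.exists_orthantMap
    obtain ⟨ε', q', rfl⟩ := y'.exists_orthantMap_eq c (by rw [← h]; exact q.2.1)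
    refine ⟨_, _, isOpen_range_orthantMap c ε, isOpen_range_orthantMap c ε', mem_range_self _,
      mem_range_self _, disjoint_range_orthantMap c ?_⟩
    rintro rfl
    exact hne (congrArg _ (Subtype.ext h))
  · obtain ⟨u, v, hu, hv, h1, h2, h3⟩ := t2_separation h
    exact ⟨_, _, hu.preimage continuous_blowDown, hv.preimage continuous_blowDown, h1, h2,
      h3.preimage _⟩

/-- The blow-down map is proper as soon as `X` is covered by normal crossing charts. -/
theorem isProperMap_blowDown (hD : ∀ p, ∃ c : NormalCrossingChart n D, p ∈ c.chart.source) :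
    IsProperMap (blowDown : RealOrientedBlowup n D → X) := by
  refine isProperMap_iff_ultrafilter.2 ⟨continuous_blowDown, fun {𝒰 p} h => ?_⟩
  obtain ⟨c, hc⟩ := hD p
  have h1 : ∀ᶠ y in (𝒰 : Filter _), ∃ ε, y ∈ range (orthantMap c ε) := by
    filter_upwards [h (c.chart.open_source.mem_nhds hc)] with y hy
    obtain ⟨ε, q, rfl⟩ := y.exists_orthantMap_eq c hy
    exact ⟨ε, mem_range_self _⟩
  -- A chart has finitely many orthants, so the ultrafilter concentrates on one. That orthant is
  -- closed in the chart and therefore contains the limit `p`.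
  obtain ⟨ε, hε⟩ := Ultrafilter.eventually_exists_iff.1 h1
  have hne : (comap (orthantMap c ε) (𝒰 : Filter (RealOrientedBlowup n D))).NeBot :=
    comap_neBot_iff.2 fun t ht => by
      obtain ⟨_, hy, q, rfl⟩ := 𝒰.nonempty_of_mem (inter_mem ht hε)
      exact ⟨q, hy⟩
  have hval : Tendsto (Subtype.val : c.closedOrthant ε → X)
      (comap (orthantMap c ε) (𝒰 : Filter (RealOrientedBlowup n D))) (𝓝 p) :=
    h.comp (tendsto_comap (f := orthantMap c ε))
  have hp : p ∈ c.closedOrthant ε :=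
    c.mem_closedOrthant_of_neBot hc hval (Eventually.of_forall fun q => q.2)
  refine ⟨orthantMap c ε ⟨p, hp⟩, rfl, ?_⟩
  have h2 : comap (orthantMap c ε) (𝒰 : Filter (RealOrientedBlowup n D)) ≤ 𝓝 ⟨p, hp⟩ := by
    rw [nhds_subtype_eq_comap]; exact tendsto_iff_comap.1 hval
  have h3 := (map_mono h2).trans ((continuous_orthantMap c ε).tendsto ⟨p, hp⟩)
  rwa [map_comap_of_mem hε] at h3

/-- The points off the divisor are dense in the blow-up. -/
theorem dense_blowDown_notMem : Dense {y : RealOrientedBlowup n D | y.blowDown ∉ D} := by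
  intro y
  obtain ⟨c, ε, q, rfl⟩ := y.exists_orthantMap
  have := c.neBot_nhdsWithin_openOrthant q.2
  have h1 : (comap (Subtype.val : c.closedOrthant ε → X) (𝓝[c.openOrthant ε] (q : X))).NeBot :=
    comap_neBot_iff.2 fun t ht => by
      obtain ⟨z, hz, hz'⟩ := (𝓝[c.openOrthant ε] (q : X)).nonempty_of_mem
        (inter_mem ht self_mem_nhdsWithin)
      exact ⟨⟨z, c.openOrthant_subset_closedOrthant ε hz'⟩, hz⟩
  have h2 : Tendsto (orthantMap c ε)
      (comap (Subtype.val : c.closedOrthant ε → X) (𝓝[c.openOrthant ε] (q : X)))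
      (𝓝 (orthantMap c ε q)) := by
    refine ((continuous_orthantMap c ε).tendsto q).mono_left ?_
    rw [nhds_subtype_eq_comap]
    exact comap_mono nhdsWithin_le_nhds
  refine mem_closure_of_tendsto h2 ?_
  filter_upwards [preimage_mem_comap self_mem_nhdsWithin] with z hz
  exact c.notMem_of_mem_openOrthant hz

/-! ### The blow-up of the map `π` -/

section LiftedMap

variable {π : X → Ioo (-1 : ℝ) 1}

/-- `π` has no zero on an open orthant, and the germ of the orthant is connected. -/
theorem side_pos_or_neg (hπ : Continuous π) (y : RealOrientedBlowup n (specialFibre π)) :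
    (∀ᶠ q in y.side, 0 < (π q : ℝ)) ∨ ∀ᶠ q in y.side, (π q : ℝ) < 0 := by
  obtain ⟨c, ε, q, rfl⟩ := y.exists_orthantMap
  have hA : IsOpen {z | 0 < (π z : ℝ)} := isOpen_lt continuous_const (by fun_prop)
  have hB : IsOpen {z | (π z : ℝ) < 0} := isOpen_lt (by fun_prop) continuous_const
  have hAB : Disjoint {z | 0 < (π z : ℝ)} {z | (π z : ℝ) < 0} :=
    disjoint_left.2 fun z (h : 0 < (π z : ℝ)) h' => lt_asymm h h'
  have hcov : ∀ z ∈ c.openOrthant ε, (π z : ℝ) < 0 ∨ 0 < (π z : ℝ) := fun z hz =>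
    lt_or_gt_of_ne (c.notMem_of_mem_openOrthant hz)
  by_cases h : ∃ᶠ z in 𝓝[c.openOrthant ε] (q : X), 0 < (π z : ℝ)
  · exact Or.inl (c.eventually_mem_of_isOpen_cover q.2 univ_mem hA hB hAB
      (fun z hz => (hcov z hz.1).symm) h)
  · refine Or.inr ?_
    filter_upwards [not_frequently.1 h, self_mem_nhdsWithin] with z hz hz'
    exact (hcov z hz').resolve_right hz

/-- Applied to `0 < π` and to `π < 0`, this makes the two halves of the blow-up open, hence clopen.
-/
theorem isOpen_side_eventually {P : X → Prop} :
    IsOpen {y : RealOrientedBlowup n D | ∀ᶠ q in y.side, P q} := by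
  refine isOpen_iff.2 fun c ε => isOpen_iff_mem_nhds.2 fun q hq => ?_
  have h : ∀ᶠ z in 𝓝 (q : X), z ∈ c.openOrthant ε → P z := eventually_nhdsWithin_iff.1 hq
  filter_upwards [continuous_subtype_val.continuousAt.eventually (eventually_eventually_nhds.2 h)]
    with z hz
  exact eventually_nhdsWithin_iff.2 hz

theorem tendsto_side (y : RealOrientedBlowup n D) : y.side ≤ 𝓝 y.blowDown := by
  obtain ⟨c, ε, q, rfl⟩ := y.exists_orthantMap
  exact nhdsWithin_le_nhds

open Classical in
/-- The real-oriented blow-up of the map `π`. -/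
noncomputable def liftedMap (π : X → Ioo (-1 : ℝ) 1)
    (y : RealOrientedBlowup n (specialFibre π)) : BlownUpInterval :=
  -- The truncations by `max` and `min` only place the value in the right interval; on the chosen
  -- side they change nothing.
  if ∀ᶠ q in y.side, 0 < (π q : ℝ) then
    Sum.inr ⟨max (π y.blowDown : ℝ) 0, le_max_right _ _, max_lt (π y.blowDown).2.2 one_pos⟩
  else Sum.inl ⟨min (π y.blowDown : ℝ) 0, lt_min (π y.blowDown).2.1 neg_one_lt_zero,
    min_le_right _ _⟩

theorem isBlowupOfMap_liftedMap (hπ : Continuous π) : IsBlowupOfMap n π (liftedMap π) where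
  continuous := by
    classical
    have hα := continuous_blowDown (n := n) (D := specialFibre π)
    have hclopen : IsClopen {y : RealOrientedBlowup n (specialFibre π) |
        ∀ᶠ q in y.side, 0 < (π q : ℝ)} := by
      refine ⟨⟨?_⟩, isOpen_side_eventually⟩
      convert isOpen_side_eventually (n := n) (D := specialFibre π)
        (P := fun q => (π q : ℝ) < 0) using 1
      ext y
      have := y.side_neBot
      refine ⟨fun h => (side_pos_or_neg hπ y).resolve_left h, fun h h' => ?_⟩
      obtain ⟨q, h1, h2⟩ := (Eventually.and h h').exists
      exact lt_asymm h1 h2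
    unfold liftedMap
    refine Continuous.if (fun y hy => ?_) ?_ ?_
    · rw [hclopen.frontier_eq] at hy
      exact hy.elim
    · exact continuous_inr.comp (Continuous.subtype_mk (by fun_prop) _)
    · exact continuous_inl.comp (Continuous.subtype_mk (by fun_prop) _)
  comm y := by
    have := y.side_neBot
    have hlim : Tendsto (fun q => (π q : ℝ)) y.side (𝓝 (π y.blowDown : ℝ)) :=
      ((continuous_subtype_val.comp hπ).tendsto _).mono_left (tendsto_side y)
    refine Subtype.ext ?_
    unfold liftedMap
    split_ifs with h
    · exact max_eq_left (ge_of_tendsto hlim (h.mono fun _ h => le_of_lt h))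
    · exact min_eq_left (le_of_tendsto hlim
        (((side_pos_or_neg hπ y).resolve_left h).mono fun _ h => le_of_lt h))

theorem _root_.BlownUpInterval.eq_of_blowDown_eq {a b : BlownUpInterval}
    (h : a.blowDown = b.blowDown) (h0 : (a.blowDown : ℝ) ≠ 0) : a = b := by
  have h' : (a.blowDown : ℝ) = b.blowDown := congrArg _ h
  rcases a with ⟨a, ha⟩ | ⟨a, ha⟩ <;> rcases b with ⟨b, hb⟩ | ⟨b, hb⟩ <;>
    change a = b at h' <;> change a ≠ 0 at h0 <;> subst h'
  · rfl
  · exact absurd (le_antisymm ha.2 hb.1) h0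
  · exact absurd (le_antisymm hb.2 ha.1) h0
  · rfl

/-- Away from zero `β` is injective, so two lifts agree off the divisor, which is a dense set; the
target is Hausdorff. -/
theorem _root_.IsBlowupOfMap.eq_liftedMap (hπ : Continuous π)
    {f : RealOrientedBlowup n (specialFibre π) → BlownUpInterval} (hf : IsBlowupOfMap n π f) :
    f = liftedMap π := by
  have hg := isBlowupOfMap_liftedMap (n := n) hπ
  refine Continuous.ext_on dense_blowDown_notMem hf.continuous hg.continuous fun y hy => ?_
  refine BlownUpInterval.eq_of_blowDown_eq ((hf.comm y).trans (hg.comm y).symm) ?_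
  rw [hf.comm]; exact hy

theorem liftedMap_mem_positiveHalf_iff {y : RealOrientedBlowup n (specialFibre π)} :
    liftedMap π y ∈ BlownUpInterval.positiveHalf ↔ ∀ᶠ q in y.side, 0 < (π q : ℝ) := by
  unfold liftedMap BlownUpInterval.positiveHalf
  split_ifs with h <;> simp [h]

end LiftedMap

end RealOrientedBlowup

theorem OpenPartialHomeomorph.eventuallyEq_comp_symm {X E : Type*} [TopologicalSpace X]
    [TopologicalSpace E] {e : OpenPartialHomeomorph X E} {q : X} (hq : q ∈ e.source) (f : X → ℝ) :
    f =ᶠ[𝓝 q] fun z => (f ∘ e.symm) (e z) := by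
  filter_upwards [e.open_source.mem_nhds hq] with z hz
  rw [Function.comp_apply, e.left_inv hz]

/-! ### Derivatives and constant vector fields in charts -/

section ChartFields

variable {n : ℕ} {X : Type*} [TopologicalSpace X] [ChartedSpace (EuclideanSpace ℝ (Fin n)) X]

/-- The derivative of a real function on a manifold, as a functional on the tangent space. -/
noncomputable def dirDeriv (f : X → ℝ) (q : X) : TangentSpace (𝓡 n) q →L[ℝ] ℝ :=
  mfderiv (𝓡 n) 𝓘(ℝ, ℝ) f q

/-- The vector field with constant coordinate vector `u` in the chart `e`. -/
noncomputable def constField (e : OpenPartialHomeomorph X (EuclideanSpace ℝ (Fin n)))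
    (u : EuclideanSpace ℝ (Fin n)) (q : X) : TangentSpace (𝓡 n) q :=
  VectorField.mpullback (𝓡 n) 𝓘(ℝ, EuclideanSpace ℝ (Fin n)) e (fun _ => u) q

variable {e : OpenPartialHomeomorph X (EuclideanSpace ℝ (Fin n))}

theorem mdifferentiable_of_mem_maximalAtlas (he : e ∈ IsManifold.maximalAtlas (𝓡 n) ∞ X) :
    e.MDifferentiable (𝓡 n) 𝓘(ℝ, EuclideanSpace ℝ (Fin n)) :=
  ⟨(contMDiffOn_of_mem_maximalAtlas he).mdifferentiableOn (by simp),
    (contMDiffOn_symm_of_mem_maximalAtlas he).mdifferentiableOn (by simp)⟩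

theorem isInvertible_mfderiv_of_mem_maximalAtlas (he : e ∈ IsManifold.maximalAtlas (𝓡 n) ∞ X)
    {q : X} (hq : q ∈ e.source) :
    (mfderiv (𝓡 n) 𝓘(ℝ, EuclideanSpace ℝ (Fin n)) e q).IsInvertible :=
  ⟨(mdifferentiable_of_mem_maximalAtlas he).mfderiv hq, rfl⟩

theorem isInvertible_mfderiv_symm_of_mem_maximalAtlas
    (he : e ∈ IsManifold.maximalAtlas (𝓡 n) ∞ X)
    {x : EuclideanSpace ℝ (Fin n)} (hx : x ∈ e.target) :
    (mfderiv 𝓘(ℝ, EuclideanSpace ℝ (Fin n)) (𝓡 n) e.symm x).IsInvertible :=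
  ⟨(mdifferentiable_of_mem_maximalAtlas he).symm.mfderiv hx, rfl⟩

theorem mfderiv_constField (he : e ∈ IsManifold.maximalAtlas (𝓡 n) ∞ X)
    {q : X} (hq : q ∈ e.source) (u : EuclideanSpace ℝ (Fin n)) :
    mfderiv (𝓡 n) 𝓘(ℝ, EuclideanSpace ℝ (Fin n)) e q (constField e u q) = u :=
  (isInvertible_mfderiv_of_mem_maximalAtlas he hq).self_apply_inverse u

theorem contMDiffAt_constField [IsManifold (𝓡 n) ∞ X]
    (he : e ∈ IsManifold.maximalAtlas (𝓡 n) ∞ X)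
    {q : X} (hq : q ∈ e.source) (u : EuclideanSpace ℝ (Fin n)) :
    ContMDiffAt (𝓡 n) (𝓡 n).tangent 1
      (fun x => (⟨x, constField e u x⟩ : TangentBundle (𝓡 n) X)) q := by
  have : IsManifold (𝓡 n) 2 X := IsManifold.of_le (n := ∞) (by norm_cast)
  have h1 : ContMDiffAt (𝓡 n) 𝓘(ℝ, EuclideanSpace ℝ (Fin n)) 2 e q :=
    (contMDiffAt_of_mem_maximalAtlas he hq).of_le (by norm_cast)
  refine ContMDiffAt.mpullback_vectorField_preimage (m := 1) (n := 2)
    (V := fun _ : EuclideanSpace ℝ (Fin n) => u) ?_ h1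
    (isInvertible_mfderiv_of_mem_maximalAtlas he hq) (by norm_num)
  exact contMDiffAt_vectorSpace_iff_contDiffAt.2 contDiffAt_const

theorem dirDeriv_eq_fderiv (he : e ∈ IsManifold.maximalAtlas (𝓡 n) ∞ X)
    {q : X} (hq : q ∈ e.source) {f : X → ℝ} {F : EuclideanSpace ℝ (Fin n) → ℝ}
    (hF : DifferentiableAt ℝ F (e q)) (hf : f =ᶠ[𝓝 q] fun z => F (e z))
    (V : TangentSpace (𝓡 n) q) :
    dirDeriv f q V = fderiv ℝ F (e q) (mfderiv (𝓡 n) 𝓘(ℝ, EuclideanSpace ℝ (Fin n)) e q V) := by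
  have h1 : HasMFDerivAt 𝓘(ℝ, EuclideanSpace ℝ (Fin n)) 𝓘(ℝ, ℝ) F (e q) (fderiv ℝ F (e q)) :=
    hF.hasFDerivAt.hasMFDerivAt
  have h2 := ((mdifferentiable_of_mem_maximalAtlas he).mdifferentiableAt hq).hasMFDerivAt
  have h3 := (h1.comp q h2).congr_of_eventuallyEq (f₁ := f) hf
  unfold dirDeriv
  rw [h3.mfderiv]
  rfl

theorem dirDeriv_constField (he : e ∈ IsManifold.maximalAtlas (𝓡 n) ∞ X)
    {q : X} (hq : q ∈ e.source) {f : X → ℝ} {F : EuclideanSpace ℝ (Fin n) → ℝ}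
    (hF : DifferentiableAt ℝ F (e q)) (hf : f =ᶠ[𝓝 q] fun z => F (e z))
    (u : EuclideanSpace ℝ (Fin n)) :
    dirDeriv f q (constField e u q) = fderiv ℝ F (e q) u := by
  rw [dirDeriv_eq_fderiv he hq hF hf, mfderiv_constField he hq]

theorem exists_constField_eq (he : e ∈ IsManifold.maximalAtlas (𝓡 n) ∞ X)
    {q : X} (hq : q ∈ e.source) (V : TangentSpace (𝓡 n) q) : ∃ u, constField e u q = V :=
  ⟨mfderiv (𝓡 n) 𝓘(ℝ, EuclideanSpace ℝ (Fin n)) e q V,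
    (isInvertible_mfderiv_of_mem_maximalAtlas he hq).inverse_apply_self V⟩

theorem contDiffAt_comp_symm (he : e ∈ IsManifold.maximalAtlas (𝓡 n) ∞ X)
    {q : X} (hq : q ∈ e.source) {f : X → ℝ} (hf : ContMDiffAt (𝓡 n) 𝓘(ℝ, ℝ) ∞ f q) :
    ContDiffAt ℝ ∞ (f ∘ e.symm) (e q) := by
  have h1 := contMDiffAt_symm_of_mem_maximalAtlas he (e.map_source hq)
  have h2 : ContMDiffAt (𝓡 n) 𝓘(ℝ, ℝ) ∞ f (e.symm (e q)) := by rwa [e.left_inv hq]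
  exact (h2.comp (e q) h1).contDiffAt

end ChartFields

/-- A nonzero functional which is nonnegative near a vector is positive on it. -/
theorem ContinuousLinearMap.pos_of_eventually_nonneg {E : Type*} [NormedAddCommGroup E]
    [NormedSpace ℝ E] {L : E →L[ℝ] ℝ} (hL : L ≠ 0) {u : E} (h : ∀ᶠ u' in 𝓝 u, 0 ≤ L u') :
    0 < L u := by
  obtain ⟨z, hz⟩ : ∃ z, L z < 0 := by
    by_contra! hz
    exact hL (ContinuousLinearMap.ext fun z => le_antisymm (by simpa using hz (-z)) (hz z))
  have h1 : Tendsto (fun s : ℝ => u + s • z) (𝓝[>] 0) (𝓝 u) := by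
    have : Continuous fun s : ℝ => u + s • z := by fun_prop
    simpa using (this.tendsto 0).mono_left (nhdsWithin_le_nhds (s := Ioi 0))
  obtain ⟨s, hs, hs'⟩ := ((h1.eventually h).and self_mem_nhdsWithin).exists
  rw [map_add, map_smul, smul_eq_mul] at hs
  have : s * L z < 0 := mul_neg_of_pos_of_neg hs' hz
  linarith

theorem fderiv_nonneg_of_eventually_le {E : Type*} [NormedAddCommGroup E] [NormedSpace ℝ E]
    {F : E → ℝ} {x u : E} (hF : DifferentiableAt ℝ F x)
    (h : ∀ᶠ s in 𝓝[>] (0 : ℝ), F x ≤ F (x + s • u)) : 0 ≤ fderiv ℝ F x u := by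
  have h1 : HasDerivAt (fun s : ℝ => F (x + s • u)) (fderiv ℝ F x u) 0 := by
    have h2 : HasDerivAt (fun s : ℝ => x + s • u) u 0 := by
      simpa using ((hasDerivAt_id (0 : ℝ)).smul_const u).const_add x
    have h3 : HasFDerivAt F (fderiv ℝ F x) (x + (0 : ℝ) • u) := by simpa using hF.hasFDerivAt
    exact h3.comp_hasDerivAt (0 : ℝ) h2
  have h4 := (hasDerivAt_iff_tendsto_slope.1 h1).mono_left
    (nhdsWithin_mono (0 : ℝ) (fun s (hs : (0 : ℝ) < s) => hs.ne') : 𝓝[>] (0 : ℝ) ≤ _)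
  refine ge_of_tendsto h4 ?_
  filter_upwards [h, self_mem_nhdsWithin] with s hs hs'
  rw [slope_def_field, zero_smul, add_zero, sub_zero]
  exact div_nonneg (sub_nonneg.2 hs) (le_of_lt hs')

namespace NormalCrossingChart

variable {n : ℕ} {X : Type*} [TopologicalSpace X] [ChartedSpace (EuclideanSpace ℝ (Fin n)) X]
  {D : Set X}

theorem contMDiffAt_coord (c : NormalCrossingChart n D) (i : Fin c.k) {q : X}
    (hq : q ∈ c.chart.source) : ContMDiffAt (𝓡 n) 𝓘(ℝ, ℝ) ∞ (c.coord i) q := by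
  have h1 := contMDiffAt_of_mem_maximalAtlas c.mem_atlas hq
  have h2 : ContMDiffAt 𝓘(ℝ, EuclideanSpace ℝ (Fin n)) 𝓘(ℝ, ℝ) ∞
      (EuclideanSpace.proj (𝕜 := ℝ) (Fin.castLE c.k_le i)) (c.chart q) :=
    (ContinuousLinearMap.contDiff _).contMDiff.contMDiffAt
  exact h2.comp q h1

theorem dirDeriv_coord (c : NormalCrossingChart n D) (i : Fin c.k) {q : X}
    (hq : q ∈ c.chart.source) (V : TangentSpace (𝓡 n) q) :
    dirDeriv (c.coord i) q V =
      EuclideanSpace.proj (𝕜 := ℝ) (Fin.castLE c.k_le i)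
        (mfderiv (𝓡 n) 𝓘(ℝ, EuclideanSpace ℝ (Fin n)) c.chart q V) := by
  rw [dirDeriv_eq_fderiv c.mem_atlas hq (f := c.coord i)
    (F := EuclideanSpace.proj (𝕜 := ℝ) (Fin.castLE c.k_le i))
    (ContinuousLinearMap.differentiableAt _) (Eventually.of_forall fun _ => rfl),
    ContinuousLinearMap.fderiv]

/-- A vector which points strictly into an orthant of one chart also points strictly into the
corresponding orthant of any other chart. -/
theorem dirDeriv_coord_pos (c c' : NormalCrossingChart n D) {ε : Fin c.k → ℤˣ}
    {ε' : Fin c'.k → ℤˣ} {q : X} (hq : q ∈ c.closedOrthant ε) (hq' : q ∈ c'.closedOrthant ε')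
    (h : 𝓝[c.openOrthant ε] q = 𝓝[c'.openOrthant ε'] q) {u : EuclideanSpace ℝ (Fin n)}
    (hu : ∀ i, 0 < ((ε' i : ℤ) : ℝ) * u (Fin.castLE c'.k_le i)) {i : Fin c.k}
    (hi : c.coord i q = 0) :
    0 < ((ε i : ℤ) : ℝ) * dirDeriv (c.coord i) q (constField c'.chart u q) := by
  set F : EuclideanSpace ℝ (Fin n) → ℝ := c.coord i ∘ c'.chart.symm with hF
  have hFd : DifferentiableAt ℝ F (c'.chart q) :=
    (contDiffAt_comp_symm c'.mem_atlas hq'.1 (c.contMDiffAt_coord i hq.1)).differentiableAt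
      (by simp)
  have hdir : ∀ u', dirDeriv (c.coord i) q (constField c'.chart u' q) =
      fderiv ℝ F (c'.chart q) u' := fun u' =>
    dirDeriv_constField c'.mem_atlas hq'.1 hFd (OpenPartialHomeomorph.eventuallyEq_comp_symm hq'.1 _) u'
  have hFq : F (c'.chart q) = 0 := by rw [hF, Function.comp_apply, c'.chart.left_inv hq'.1, hi]
  set L : EuclideanSpace ℝ (Fin n) →L[ℝ] ℝ := ((ε i : ℤ) : ℝ) • fderiv ℝ F (c'.chart q) with hLdef
  -- A coordinate function has nonzero differential, as the sign vector of its own chart detects.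
  have hL : L ≠ 0 := by
    intro hL0
    obtain ⟨u', hu'⟩ := exists_constField_eq c'.mem_atlas hq'.1
      (constField c.chart (signVector ε) q)
    have h1 : L u' = 0 := by rw [hL0]; rfl
    rw [hLdef, smul_apply, ← hdir, hu', c.dirDeriv_coord i hq.1,
      mfderiv_constField c.mem_atlas hq.1, smul_eq_mul] at h1
    exact (c.signVector_inward ε i).ne' h1
  -- Every direction near `u` still enters the common germ, on which `ε i` times the coordinate is
  -- positive while it vanishes at `q`. Its derivative is thus nonnegative on an open set of
  -- directions, and, being a nonzero functional, positive at `u`.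
  have hpos : ∀ᶠ u' in 𝓝 u, 0 ≤ L u' := by
    have h2 : ∀ᶠ u' in 𝓝 u, ∀ i, 0 < ((ε' i : ℤ) : ℝ) * u' (Fin.castLE c'.k_le i) := by
      refine eventually_all.2 fun j => ?_
      have : Continuous fun u' : EuclideanSpace ℝ (Fin n) =>
        ((ε' j : ℤ) : ℝ) * u' (Fin.castLE c'.k_le j) := by fun_prop
      exact this.continuousAt.eventually (Ioi_mem_nhds (hu j))
    filter_upwards [h2] with u' hu'
    have h3 : DifferentiableAt ℝ (fun x => ((ε i : ℤ) : ℝ) * F x) (c'.chart q) :=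
      hFd.const_mul _
    have h4 : fderiv ℝ (fun x => ((ε i : ℤ) : ℝ) * F x) (c'.chart q) = L :=
      fderiv_const_mul hFd _
    rw [← h4]
    refine fderiv_nonneg_of_eventually_le h3 ?_
    have h5 : Tendsto (fun s : ℝ => c'.chart.symm (c'.chart q + s • u')) (𝓝[>] 0)
        (𝓝[c'.openOrthant ε'] q) := tendsto_nhdsWithin_iff.2
      ⟨c'.tendsto_chart_symm_add_smul hq'.1 u', c'.eventually_mem_openOrthant hq' hu'⟩
    rw [← h] at h5
    filter_upwards [h5.eventually self_mem_nhdsWithin] with s hs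
    rw [hFq, mul_zero]
    exact (hs.2 i).le
  have := ContinuousLinearMap.pos_of_eventually_nonneg hL hpos
  rwa [hLdef, smul_apply, ← hdir] at this

end NormalCrossingChart

/-! ### Charts adapted to `π` -/

/-- A normal crossing chart at `p` which is adapted to `π`, together with, for every orthant, a
direction pointing strictly into it along which `π` increases wherever it is positive. -/
structure AdaptedChart {n : ℕ} {X : Type*} [TopologicalSpace X]
    [ChartedSpace (EuclideanSpace ℝ (Fin n)) X] (π : X → Ioo (-1 : ℝ) 1) (p : X) extends
    NormalCrossingChart n (specialFibre π) where
  mem_source : p ∈ chart.source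
  direction : (Fin k → ℤˣ) → EuclideanSpace ℝ (Fin n)
  inward : ∀ ε i, 0 < ((ε i : ℤ) : ℝ) * direction ε (Fin.castLE k_le i)
  ascending : ∀ q ∈ chart.source, 0 < (π q : ℝ) →
    0 < dirDeriv (fun z => (π z : ℝ)) q
      (constField chart (direction (toNormalCrossingChart.signs q)) q)
  -- In the second case the chart is centred, so all `k` coordinates vanish at `p` and inwardness at
  -- `p` constrains every one of them.
  normal_form : ((π p : ℝ) ≠ 0 ∧ k = 0) ∨
    0 < k ∧ chart p = 0 ∧ ∀ q ∈ chart.source, (π q : ℝ) = ∏ i, toNormalCrossingChart.coord i q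

section

variable {n : ℕ} {X : Type*} [TopologicalSpace X] [ChartedSpace (EuclideanSpace ℝ (Fin n)) X]
  {π : X → Ioo (-1 : ℝ) 1}

/-- The derivative is the sum of the terms `ε i * ∏_{j ≠ i} x j`. Each is positive, since
multiplying it by `(x i)²` gives the product of the positive numbers `∏ x j` and `ε i * x i`. -/
theorem fderiv_prod_coord_pos {k : ℕ} (hk : k ≤ n) (hk0 : 0 < k) {ε : Fin k → ℤˣ}
    {x : EuclideanSpace ℝ (Fin n)}
    (hε : ∀ i, 0 < ((ε i : ℤ) : ℝ) * x (Fin.castLE hk i))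
    (hx : 0 < ∏ i : Fin k, x (Fin.castLE hk i)) :
    DifferentiableAt ℝ (fun y : EuclideanSpace ℝ (Fin n) => ∏ i : Fin k, y (Fin.castLE hk i)) x ∧
    0 < fderiv ℝ (fun y : EuclideanSpace ℝ (Fin n) => ∏ i : Fin k, y (Fin.castLE hk i)) x
      (signVector ε) := by
  have h := HasFDerivAt.finsetProd (u := Finset.univ) (x := x)
    (g := fun (i : Fin k) (y : EuclideanSpace ℝ (Fin n)) => y (Fin.castLE hk i))
    (g' := fun i => EuclideanSpace.proj (𝕜 := ℝ) (Fin.castLE hk i))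
    (fun i _ => (EuclideanSpace.proj (𝕜 := ℝ) (Fin.castLE hk i)).hasFDerivAt)
  refine ⟨h.differentiableAt, ?_⟩
  rw [h.fderiv, sum_apply]
  refine Finset.sum_pos (fun i _ => ?_) ⟨⟨0, hk0⟩, Finset.mem_univ _⟩
  have h1 := Finset.mul_prod_erase Finset.univ (fun i : Fin k => x (Fin.castLE hk i))
    (Finset.mem_univ i)
  rw [smul_apply, PiLp.proj_apply, signVector_castLE, smul_eq_mul]
  rw [← h1] at hx
  set P := ∏ j ∈ Finset.univ.erase i, x (Fin.castLE hk j)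
  have h2 := hε i
  set y := x (Fin.castLE hk i)
  set a := ((ε i : ℤ) : ℝ)
  have h3 : 0 < (P * a) * (y * y) := by nlinarith [mul_pos hx h2]
  exact pos_of_mul_pos_left h3 (mul_self_nonneg y)

variable [IsManifold (𝓡 n) ∞ X]

/-- On the special fibre the normal form with the sign vectors works. Elsewhere a chart is shrunk
off the special fibre, so `k = 0`, and submersivity supplies a direction of increase that persists
nearby; where `π` is negative nothing is required. -/
theorem exists_adaptedChart (hπ : IsSmoothSemistableDegeneration n π) (p : X) :
    Nonempty (AdaptedChart (n := n) π p) := by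
  have hcont : Continuous π := hπ.isProper.continuous
  have hsmooth := hπ.normalCrossing.smooth
  by_cases hp : (π p : ℝ) = 0
  · obtain ⟨e, he, hpe, hep, k, hk, hk1, hprod⟩ := hπ.normalCrossing.exists_chart p hp
    let c : NormalCrossingChart n (specialFibre π) :=
      ⟨e, he, k, hk, fun q hq => by rw [← hprod q hq]; rfl⟩
    refine ⟨{ c with
      mem_source := hpe
      direction := signVector
      inward := c.signVector_inward
      ascending := fun q hq hpos => ?_
      normal_form := Or.inr ⟨hk1, hep, hprod⟩ }⟩
    have hqD : q ∉ specialFibre π := hpos.ne'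
    have hpos' := hpos
    rw [hprod q hq] at hpos'
    obtain ⟨h1, h2⟩ := fderiv_prod_coord_pos hk hk1 (c.mem_openOrthant_signs hq hqD).2 hpos'
    rw [dirDeriv_constField he hq h1]
    · exact h2
    · filter_upwards [e.open_source.mem_nhds hq] with z hz using hprod z hz
  · -- a chart around `p` avoiding the special fibre
    obtain ⟨u, hu⟩ : ∃ u, (0 < (π p : ℝ) → 0 < dirDeriv (fun z => (π z : ℝ)) p
        (constField (chartAt (EuclideanSpace ℝ (Fin n)) p) u p)) := by
      obtain ⟨V, hV⟩ := hπ.submersive p hp (1 : ℝ)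
      obtain ⟨u, hu⟩ := exists_constField_eq (IsManifold.chart_mem_maximalAtlas (I := 𝓡 n)
        (n := ∞) p) (mem_chart_source _ p) V
      refine ⟨u, fun _ => ?_⟩
      rw [hu]
      have : dirDeriv (fun z => (π z : ℝ)) p V = 1 := hV
      rw [this]; exact one_pos
    set e := chartAt (EuclideanSpace ℝ (Fin n)) p with he_def
    have he : e ∈ IsManifold.maximalAtlas (𝓡 n) ∞ X := IsManifold.chart_mem_maximalAtlas p
    set F : EuclideanSpace ℝ (Fin n) → ℝ := (fun z => (π z : ℝ)) ∘ e.symm with hF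
    have hFc : ∀ q ∈ e.source, ContDiffAt ℝ ∞ F (e q) := fun q hq =>
      contDiffAt_comp_symm he hq hsmooth.contMDiffAt
    have hdir : ∀ q ∈ e.source, dirDeriv (fun z => (π z : ℝ)) q (constField e u q) =
        fderiv ℝ F (e q) u := fun q hq =>
      dirDeriv_constField he hq ((hFc q hq).differentiableAt (by simp))
        (OpenPartialHomeomorph.eventuallyEq_comp_symm hq _) u
    have hpe : p ∈ e.source := mem_chart_source _ p
    have hnear : ∀ᶠ q in 𝓝 p, (π q : ℝ) ≠ 0 ∧ q ∈ e.source ∧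
        (0 < (π q : ℝ) → 0 < fderiv ℝ F (e q) u) := by
      have hπc : ContinuousAt (fun q => (π q : ℝ)) p := by fun_prop
      have h0 : ∀ᶠ q in 𝓝 p, (π q : ℝ) ≠ 0 := hπc.eventually_ne hp
      rcases lt_or_gt_of_ne hp with hneg | hpos
      · filter_upwards [h0, e.open_source.mem_nhds hpe, hπc.eventually (Iio_mem_nhds hneg)]
          with q h1 h2 h3
        exact ⟨h1, h2, fun h => absurd h (lt_asymm h3)⟩
      · have hc : ContinuousAt (fun q => fderiv ℝ F (e q) u) p := by
          have h1 : ContinuousAt (fun x => fderiv ℝ F x u) (e p) :=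
            (((hFc p hpe).fderiv_right (m := 0) (by simp)).continuousAt).clm_apply
              continuousAt_const
          exact ContinuousAt.comp (f := e) (x := p) h1 (e.continuousAt hpe)
        have h2 := hu hpos
        rw [hdir p hpe] at h2
        filter_upwards [h0, e.open_source.mem_nhds hpe, hc.eventually (Ioi_mem_nhds h2)]
          with q h1 h2 h3 using ⟨h1, h2, fun _ => h3⟩
    obtain ⟨U, hU, hUo, hpU⟩ := eventually_nhds_iff.1 hnear
    have hsrc : (e.restr U).source = e.source ∩ U := by
      rw [e.restr_source, hUo.interior_eq]
    refine ⟨{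
      chart := e.restr U
      mem_atlas := restr_mem_maximalAtlas (contDiffGroupoid ∞ (𝓡 n)) he hUo
      k := 0
      k_le := Nat.zero_le n
      mem_iff := fun q hq => ?_
      mem_source := by rw [hsrc]; exact ⟨hpe, hpU⟩
      direction := fun _ => u
      inward := fun _ i => i.elim0
      ascending := fun q hq hpos => ?_
      normal_form := Or.inl ⟨hp, rfl⟩ }⟩
    · rw [hsrc] at hq
      rw [Finset.univ_eq_empty, Finset.prod_empty]
      exact iff_of_false (hU q hq.2).1 one_ne_zero
    · rw [hsrc] at hq
      have h1 := (hU q hq.2).2.2 hpos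
      rw [← hdir q hq.1] at h1
      exact h1

end

/-- Every point of `X` lies in a normal crossing chart of the special fibre. -/
theorem exists_normalCrossingChart {n : ℕ} {X : Type*} [TopologicalSpace X]
    [ChartedSpace (EuclideanSpace ℝ (Fin n)) X] [IsManifold (𝓡 n) ∞ X]
    {π : X → Ioo (-1 : ℝ) 1} (hπ : IsSmoothSemistableDegeneration n π) (p : X) :
    ∃ c : NormalCrossingChart n (specialFibre π), p ∈ c.chart.source := by
  obtain ⟨A⟩ := exists_adaptedChart hπ p
  exact ⟨A.toNormalCrossingChart, A.mem_source⟩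

/-! ### The ascending vector field -/

section AscendingField

variable {n : ℕ} {X : Type*} [TopologicalSpace X] [ChartedSpace (EuclideanSpace ℝ (Fin n)) X]
  {π : X → Ioo (-1 : ℝ) 1}

theorem IsProperMap.sigmaCompactSpace {Y Z : Type*} [TopologicalSpace Y] [TopologicalSpace Z]
    [SigmaCompactSpace Z] {f : Y → Z} (hf : IsProperMap f) : SigmaCompactSpace Y :=
  ⟨fun m => f ⁻¹' compactCovering Z m,
    fun m => hf.isCompact_preimage (isCompact_compactCovering Z m), by
      rw [← preimage_iUnion, iUnion_compactCovering, preimage_univ]⟩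

/-- A vector field along which `π` increases where it is positive, and which, on the germ of any
orthant, extends smoothly over the special fibre and points strictly into the orthant. -/
theorem exists_ascending_vectorField [T2Space X] [IsManifold (𝓡 n) ∞ X]
    (hπ : IsSmoothSemistableDegeneration n π) :
    ∃ v : (q : X) → TangentSpace (𝓡 n) q,
      (∀ q, 0 < (π q : ℝ) → 0 < dirDeriv (fun z => (π z : ℝ)) q (v q)) ∧
      ∀ (c : NormalCrossingChart n (specialFibre π)) (ε : Fin c.k → ℤˣ),
        ∀ p ∈ c.closedOrthant ε, ∃ w : (q : X) → TangentSpace (𝓡 n) q,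
          ContMDiffAt (𝓡 n) (𝓡 n).tangent 1
            (fun x => (⟨x, w x⟩ : TangentBundle (𝓡 n) X)) p ∧
          (∀ᶠ q in 𝓝[c.openOrthant ε] p, v q = w q) ∧
          ∀ i, c.coord i p = 0 → 0 < ((ε i : ℤ) : ℝ) * dirDeriv (c.coord i) p (w p) := by
  let A : ∀ p, AdaptedChart (n := n) π p := fun p => (exists_adaptedChart hπ p).some
  have : LocallyCompactSpace (Ioo (-1 : ℝ) 1) := isOpen_Ioo.locallyCompactSpace
  -- No countability is assumed on `X`: the σ-compactness needed for partitions of unity is pulled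
  -- back from the interval by the proper map `π`.
  have : SigmaCompactSpace X := hπ.isProper.sigmaCompactSpace
  obtain ⟨χ, hχ⟩ := SmoothPartitionOfUnity.exists_isSubordinate (𝓡 n) (M := X) isClosed_univ
    (fun p => (A p).chart.source) (fun p => (A p).chart.open_source)
    (fun p _ => mem_iUnion.2 ⟨p, (A p).mem_source⟩)
  -- The direction is chosen according to the orthant containing `q`, so this field may jump across
  -- the special fibre.
  let V : (j q : X) → TangentSpace (𝓡 n) q := fun j q =>
    constField (A j).chart ((A j).direction ((A j).signs q)) q
  let v : (q : X) → TangentSpace (𝓡 n) q := fun q => ∑ᶠ j, χ j q • V j q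
  have hv : ∀ (F : Finset X) (q : X), χ.fintsupport q ⊆ F → v q = ∑ j ∈ F, χ j q • V j q := by
    intro F q hF
    refine finsum_eq_sum_of_support_subset _ fun j hj => hF ?_
    rw [SmoothPartitionOfUnity.mem_fintsupport_iff]
    exact subset_tsupport _ (left_ne_zero_of_smul hj)
  have hsrc : ∀ q, ∀ j ∈ χ.fintsupport q, q ∈ (A j).chart.source := fun q j hj =>
    hχ j ((χ.mem_fintsupport_iff q j).1 hj)
  -- positivity passes to convex combinations
  have hpos : ∀ (q : X) (L : TangentSpace (𝓡 n) q →L[ℝ] ℝ) (W : X → TangentSpace (𝓡 n) q),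
      (∀ j ∈ χ.fintsupport q, 0 < L (W j)) →
      0 < L (∑ j ∈ χ.fintsupport q, χ j q • W j) := by
    intro q L W hW
    rw [map_sum]
    obtain ⟨j, hj⟩ := χ.exists_pos_of_mem (mem_univ q)
    have hjm : j ∈ χ.fintsupport q :=
      (χ.mem_fintsupport_iff q j).2 (subset_tsupport _ hj.ne')
    refine Finset.sum_pos' (fun i hi => ?_) ⟨j, hjm, ?_⟩
    · rw [map_smul, smul_eq_mul]
      exact mul_nonneg (χ.nonneg i q) (hW i hi).le
    · rw [map_smul, smul_eq_mul]
      exact mul_pos hj (hW j hjm)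
  refine ⟨v, fun q hq => ?_, fun c ε p hp => ?_⟩
  · rw [hv _ q subset_rfl]
    exact hpos q _ _ fun j hj => (A j).ascending q (hsrc q j hj) hq
  · have hgerm : ∀ j, ∃ ε' : Fin (A j).k → ℤˣ, j ∈ χ.fintsupport p →
        p ∈ (A j).closedOrthant ε' ∧
        𝓝[c.openOrthant ε] p = 𝓝[(A j).openOrthant ε'] p := by
      intro j
      by_cases hj : j ∈ χ.fintsupport p
      · obtain ⟨ε', h1, h2⟩ := c.exists_nhdsWithin_eq (A j).toNormalCrossingChart hp
          (hsrc p j hj)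
        exact ⟨ε', fun _ => ⟨h1, h2⟩⟩
      · exact ⟨1, fun h => absurd h hj⟩
    choose η hη using hgerm
    -- Freezing the orthants `η j` selected by the germ at `p` removes the jumps: the frozen sum is
    -- smooth near `p` and equals `v` on that germ.
    let W : (j q : X) → TangentSpace (𝓡 n) q := fun j q =>
      constField (A j).chart ((A j).direction (η j)) q
    refine ⟨fun q => ∑ j ∈ χ.fintsupport p, χ j q • W j q, ?_, ?_, ?_⟩
    · refine ContMDiffAt.sum_section fun j hj => ?_
      refine ContMDiffAt.smul_section (f := fun q => χ j q) ?_
        (contMDiffAt_constField (A j).mem_atlas (hsrc p j hj) _)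
      exact ((χ j).contMDiff.of_le (by norm_cast)).contMDiffAt
    · have h1 : ∀ᶠ q in 𝓝[c.openOrthant ε] p, ∀ j ∈ χ.fintsupport p,
          q ∈ (A j).openOrthant (η j) := by
        refine (Finset.eventually_all _).2 fun j hj => ?_
        rw [(hη j hj).2]
        exact self_mem_nhdsWithin
      filter_upwards [h1, nhdsWithin_le_nhds (χ.eventually_fintsupport_subset p)] with q h2 h3
      rw [hv _ q h3]
      refine Finset.sum_congr rfl fun j hj => ?_
      have : V j q = W j q := by
        change constField _ _ q = constField _ _ q
        rw [(A j).signs_eq (h2 j hj)]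
      rw [this]
    · intro i hi
      have := hpos p (((ε i : ℤ) : ℝ) • dirDeriv (c.coord i) p) (fun j => W j p) fun j hj => by
        rw [smul_apply, smul_eq_mul]
        exact c.dirDeriv_coord_pos (A j).toNormalCrossingChart hp (hη j hj).1 (hη j hj).2
          ((A j).inward _) hi
      rwa [smul_apply, smul_eq_mul] at this

end AscendingField

/-! ### Integral curves as an equivalence relation -/

section IntegralCurves

variable {n : ℕ} {X : Type*} [TopologicalSpace X] [ChartedSpace (EuclideanSpace ℝ (Fin n)) X]
  {v : (q : X) → TangentSpace (𝓡 n) q} {U : Set X}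

/-- Two points are related if some integral curve of `v` inside `U` passes through both. -/
def IntegralRel (v : (q : X) → TangentSpace (𝓡 n) q) (U : Set X) (x y : X) : Prop :=
  ∃ (γ : ℝ → X) (a b s t : ℝ), s ∈ Ioo a b ∧ t ∈ Ioo a b ∧ IsMIntegralCurveOn γ v (Ioo a b) ∧
    (∀ r ∈ Ioo a b, γ r ∈ U) ∧ γ s = x ∧ γ t = y

theorem IntegralRel.symm {x y : X} (h : IntegralRel v U x y) : IntegralRel v U y x := by
  obtain ⟨γ, a, b, s, t, hs, ht, hγ, hU, h1, h2⟩ := h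
  exact ⟨γ, a, b, t, s, ht, hs, hγ, hU, h2, h1⟩

/-- A function which increases along `v` on `U` separates the points of each integral curve. -/
theorem IntegralRel.eq_of_apply_eq {f : X → ℝ} (hf : ContMDiff (𝓡 n) 𝓘(ℝ, ℝ) ∞ f)
    (hpos : ∀ q ∈ U, 0 < dirDeriv f q (v q)) {x y : X} (h : IntegralRel v U x y)
    (hxy : f x = f y) : x = y := by
  obtain ⟨γ, a, b, s, t, hs, ht, hγ, hU, rfl, rfl⟩ := h
  have hder : ∀ r ∈ Ioo a b, HasDerivAt (fun r => f (γ r)) (dirDeriv f (γ r) (v (γ r))) r := by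
    intro r hr
    have h1 := (hγ r hr).hasMFDerivAt (Ioo_mem_nhds hr.1 hr.2)
    have h2 := (hf.mdifferentiableAt (x := γ r) (by simp)).hasMFDerivAt
    have h3 : HasFDerivAt (fun r => f (γ r))
        ((1 : ℝ →L[ℝ] ℝ).smulRight (dirDeriv f (γ r) (v (γ r)) : ℝ)) r := by
      refine (hasMFDerivAt_iff_hasFDerivAt.1 (h2.comp r h1)).congr_fderiv ?_
      refine ContinuousLinearMap.ext fun (s : ℝ) => ?_
      change dirDeriv f (γ r) ((s : ℝ) • v (γ r)) = (s : ℝ) • dirDeriv f (γ r) (v (γ r))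
      exact map_smul _ _ _
    simpa using h3.hasDerivAt
  have hmono : StrictMonoOn (fun r => f (γ r)) (Ioo a b) := by
    refine strictMonoOn_of_deriv_pos (convex_Ioo a b)
      (fun r hr => (hder r hr).continuousAt.continuousWithinAt) fun r hr => ?_
    rw [interior_Ioo] at hr
    rw [(hder r hr).deriv]
    exact hpos _ (hU r hr)
  exact congrArg γ (hmono.injOn hs ht hxy)

variable [IsManifold (𝓡 n) ∞ X] [T2Space X]

/-- The agreement set is open by local uniqueness and closed by Hausdorffness. Regularity is asked
only along `γ`, because the ascending field is `C¹` where `π > 0` but may jump at the special fibre.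
-/
theorem IsMIntegralCurveOn.eqOn_Ioo_of_contMDiffAt {γ γ' : ℝ → X} {a b t₀ : ℝ}
    (ht₀ : t₀ ∈ Ioo a b)
    (hv : ∀ t ∈ Ioo a b, ContMDiffAt (𝓡 n) (𝓡 n).tangent 1
      (fun x => (⟨x, v x⟩ : TangentBundle (𝓡 n) X)) (γ t))
    (hγ : IsMIntegralCurveOn γ v (Ioo a b)) (hγ' : IsMIntegralCurveOn γ' v (Ioo a b))
    (h : γ t₀ = γ' t₀) : EqOn γ γ' (Ioo a b) := by
  have : IsManifold (𝓡 n) 1 X := IsManifold.of_le (n := ∞) (by norm_cast)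
  intro t ht
  refine (isPreconnected_Ioo.induction₂ (s := Ioo a b)
    (fun r r' => γ r = γ' r ↔ γ r' = γ' r') (fun r hr => ?_)
    (fun _ _ _ _ _ _ h h' => h.trans h') (fun _ _ _ _ h => h.symm) ht₀ ht).1 h
  have hmem := Ioo_mem_nhds hr.1 hr.2
  refine nhdsWithin_le_nhds ?_
  by_cases hrr : γ r = γ' r
  · have heq : γ =ᶠ[𝓝 r] γ' := isMIntegralCurveAt_eventuallyEq_of_contMDiffAt_boundaryless
      (hv r hr) (hγ.isMIntegralCurveAt hmem) (hγ'.isMIntegralCurveAt hmem) hrr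
    exact heq.mono fun r' h' => iff_of_true hrr h'
  · have h1 : ContinuousAt γ r := (hγ.continuousWithinAt hr).continuousAt hmem
    have h2 : ContinuousAt γ' r := (hγ'.continuousWithinAt hr).continuousAt hmem
    exact (h1.ne_iff_eventually_ne h2 |>.1 hrr).mono fun r' h' => iff_of_false hrr h'

/-- By uniqueness, two integral curves through `y` agree on the overlap of their time intervals
after a translation, hence glue to a curve on the union. -/
theorem IntegralRel.trans
    (hv : ∀ q ∈ U, ContMDiffAt (𝓡 n) (𝓡 n).tangent 1
      (fun x => (⟨x, v x⟩ : TangentBundle (𝓡 n) X)) q) {x y z : X}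
    (h : IntegralRel v U x y) (h' : IntegralRel v U y z) : IntegralRel v U x z := by
  classical
  obtain ⟨γ, a, b, s, t, hs, ht, hγ, hU, rfl, hy⟩ := h
  obtain ⟨γ₀, a₀, b₀, s₀, t₀, hs₀, ht₀, hγ₀, hU₀, hy₀, rfl⟩ := h'
  -- translate the second curve so that both pass through `y` at time `t`
  set d := s₀ - t with hd
  set γ' := γ₀ ∘ (· + d) with hγ'_def
  have hγ' : IsMIntegralCurveOn γ' v (Ioo (a₀ - d) (b₀ - d)) := by
    have := hγ₀.comp_add d
    convert this using 1
    ext r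
    exact and_congr sub_lt_iff_lt_add lt_sub_iff_add_lt
  have hU' : ∀ r ∈ Ioo (a₀ - d) (b₀ - d), γ' r ∈ U := fun r hr =>
    hU₀ (r + d) ⟨by linarith [hr.1], by linarith [hr.2]⟩
  have ht' : t ∈ Ioo (a₀ - d) (b₀ - d) := ⟨by linarith [hs₀.1], by linarith [hs₀.2]⟩
  have hyy : γ t = γ' t := by
    rw [hy, hγ'_def, Function.comp_apply, hd, add_sub_cancel, hy₀]
  have ht₀' : t₀ - d ∈ Ioo (a₀ - d) (b₀ - d) := ⟨by linarith [ht₀.1], by linarith [ht₀.2]⟩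
  have hz : γ' (t₀ - d) = γ₀ t₀ := by rw [hγ'_def, Function.comp_apply, sub_add_cancel]
  set a' := a₀ - d
  set b' := b₀ - d
  have hagree : EqOn γ γ' (Ioo (max a a') (min b b')) :=
    IsMIntegralCurveOn.eqOn_Ioo_of_contMDiffAt (t₀ := t)
      ⟨max_lt ht.1 ht'.1, lt_min ht.2 ht'.2⟩
      (fun r hr => hv _ (hU r (Ioo_subset_Ioo (le_max_left _ _) (min_le_left _ _) hr)))
      (hγ.mono (Ioo_subset_Ioo (le_max_left _ _) (min_le_left _ _)))
      (hγ'.mono (Ioo_subset_Ioo (le_max_right _ _) (min_le_right _ _))) hyy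
  set δ := (Ioo a b).piecewise γ γ' with hδ
  have hδ1 : EqOn δ γ (Ioo a b) := piecewise_eqOn _ _ _
  have hδ2 : EqOn δ γ' (Ioo a' b') := by
    intro r hr
    by_cases hr' : r ∈ Ioo a b
    · rw [hδ1 hr']
      exact hagree ⟨max_lt hr'.1 hr.1, lt_min hr'.2 hr.2⟩
    · rw [hδ, piecewise_eq_of_notMem _ _ _ hr']
  have hunion : Ioo (min a a') (max b b') = Ioo a b ∪ Ioo a' b' :=
    (Ioo_union_Ioo' (ht'.1.trans ht.2) (ht.1.trans ht'.2)).symm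
  have hcurve : ∀ {η : ℝ → X} {α β : ℝ}, IsMIntegralCurveOn η v (Ioo α β) →
      EqOn δ η (Ioo α β) → ∀ r ∈ Ioo α β, IsMIntegralCurveAt δ v r := by
    intro η α β hη heq r hr
    filter_upwards [Ioo_mem_nhds hr.1 hr.2] with r' hr'
    have h1 := (hη r' hr').hasMFDerivAt (Ioo_mem_nhds hr'.1 hr'.2)
    rw [heq hr']
    exact h1.congr_of_eventuallyEq (heq.eventuallyEq_of_mem (Ioo_mem_nhds hr'.1 hr'.2))
  refine ⟨δ, min a a', max b b', s, t₀ - d, ?_, ?_, ?_, ?_, hδ1 hs, (hδ2 ht₀').trans hz⟩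
  · rw [hunion]; exact Or.inl hs
  · rw [hunion]; exact Or.inr ht₀'
  · rw [hunion]
    refine IsMIntegralCurveAt.isMIntegralCurveOn fun r hr => ?_
    rcases hr with hr | hr
    · exact hcurve hγ hδ1 r hr
    · exact hcurve hγ' hδ2 r hr
  · rw [hunion]
    rintro r (hr | hr)
    · rw [hδ1 hr]; exact hU r hr
    · rw [hδ2 hr]; exact hU' r hr

end IntegralCurves

/-! ### Flow boxes in closed orthants -/

section Box

variable {n : ℕ} {X : Type*} [TopologicalSpace X] [ChartedSpace (EuclideanSpace ℝ (Fin n)) X]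
  {π : X → Ioo (-1 : ℝ) 1}

/-- The vector field `w` in the coordinates given by the chart `e`. -/
noncomputable def chartField (e : OpenPartialHomeomorph X (EuclideanSpace ℝ (Fin n)))
    (w : (q : X) → TangentSpace (𝓡 n) q) (x : EuclideanSpace ℝ (Fin n)) :
    EuclideanSpace ℝ (Fin n) :=
  mfderiv (𝓡 n) 𝓘(ℝ, EuclideanSpace ℝ (Fin n)) e (e.symm x) (w (e.symm x))

theorem mfderiv_symm_chartField {e : OpenPartialHomeomorph X (EuclideanSpace ℝ (Fin n))}
    (he : e ∈ IsManifold.maximalAtlas (𝓡 n) ∞ X) (w : (q : X) → TangentSpace (𝓡 n) q)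
    {x : EuclideanSpace ℝ (Fin n)} (hx : x ∈ e.target) :
    mfderiv 𝓘(ℝ, EuclideanSpace ℝ (Fin n)) (𝓡 n) e.symm x (chartField e w x) =
      w (e.symm x) := by
  have h := (mdifferentiable_of_mem_maximalAtlas he).symm_comp_deriv (e.map_target hx)
  have h1 := congrArg (fun L => L (w (e.symm x))) h
  rw [e.right_inv hx] at h1
  exact h1

/-- Near `e p` the coordinate expression is the pullback of `w` along `e.symm`, which preserves `C¹`
regularity. -/
theorem contDiffAt_chartField [IsManifold (𝓡 n) ∞ X]
    {e : OpenPartialHomeomorph X (EuclideanSpace ℝ (Fin n))}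
    (he : e ∈ IsManifold.maximalAtlas (𝓡 n) ∞ X) {w : (q : X) → TangentSpace (𝓡 n) q}
    {p : X} (hp : p ∈ e.source)
    (hw : ContMDiffAt (𝓡 n) (𝓡 n).tangent 1
      (fun x => (⟨x, w x⟩ : TangentBundle (𝓡 n) X)) p) :
    ContDiffAt ℝ 1 (chartField e w) (e p) := by
  have : IsManifold (𝓡 n) 2 X := IsManifold.of_le (n := ∞) (by norm_cast)
  have h1 : ContMDiffAt 𝓘(ℝ, EuclideanSpace ℝ (Fin n)) (𝓡 n) 2 e.symm (e p) :=
    (contMDiffAt_symm_of_mem_maximalAtlas he (e.map_source hp)).of_le (by norm_cast)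
  have h2 := ContMDiffAt.mpullback_vectorField_preimage (m := 1) (n := 2) (f := e.symm)
    (V := w) (x₀ := e p) (by rwa [e.left_inv hp]) h1
    (isInvertible_mfderiv_symm_of_mem_maximalAtlas he (e.map_source hp)) (by norm_num)
  refine (contMDiffAt_vectorSpace_iff_contDiffAt.1 h2).congr_of_eventuallyEq ?_
  filter_upwards [e.open_target.mem_nhds (e.map_source hp)] with x hx
  have h3 := isInvertible_mfderiv_symm_of_mem_maximalAtlas he hx
  have h4 := mfderiv_symm_chartField he w hx
  rw [VectorField.mpullback_apply, ← h4]
  exact (h3.inverse_apply_self _).symm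

/-- Flow box in a closed orthant, given a function `g` on the chart which equals `π` on the
orthant, is negative off it, and increases along the vector field. -/
theorem exists_orthant_box_of_strictMonoOn [IsManifold (𝓡 n) ∞ X]
    (c : NormalCrossingChart n (specialFibre π)) {ε : Fin c.k → ℤˣ} {p : X}
    (hp : p ∈ c.closedOrthant ε) {v w : (q : X) → TangentSpace (𝓡 n) q}
    (hw : ContMDiffAt (𝓡 n) (𝓡 n).tangent 1
      (fun x => (⟨x, w x⟩ : TangentBundle (𝓡 n) X)) p)
    {W : Set (EuclideanSpace ℝ (Fin n))} (hW : W ∈ 𝓝 (c.chart p)) (hWt : W ⊆ c.chart.target)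
    {g : EuclideanSpace ℝ (Fin n) → ℝ} (hg : ContinuousOn g W)
    (hgC : ∀ x ∈ W, c.chart.symm x ∈ c.closedOrthant ε ↔ 0 ≤ g x)
    (hgπ : ∀ x ∈ W, 0 ≤ g x → (π (c.chart.symm x) : ℝ) = g x)
    (hgv : ∀ x ∈ W, 0 < g x → v (c.chart.symm x) = w (c.chart.symm x))
    (hmono : ∀ (x : ℝ → EuclideanSpace ℝ (Fin n)) (a b : ℝ),
      (∀ s ∈ Ioo a b, HasDerivAt x (chartField c.chart w (x s)) s ∧ x s ∈ W) →
      StrictMonoOn (fun s => g (x s)) (Ioo a b)) :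
    ∃ N ∈ 𝓝 p, ∃ J : Set ℝ, IsOpen J ∧ (π p : ℝ) ∈ J ∧ ∃ τ : X × ℝ → X,
      ContinuousOn τ ((N ∩ c.closedOrthant ε) ×ˢ (J ∩ Ico 0 1)) ∧
      ∀ q ∈ N ∩ c.closedOrthant ε, (π q : ℝ) ∈ J ∧ τ (q, π q) = q ∧
        (∀ t ∈ J ∩ Ico 0 1, τ (q, t) ∈ c.closedOrthant ε ∧ (π (τ (q, t)) : ℝ) = t) ∧
        ∀ t ∈ J ∩ Ico 0 1, ∀ t' ∈ J ∩ Ico 0 1, 0 < t → 0 < t' →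
          IntegralRel v {q | 0 < (π q : ℝ)} (τ (q, t)) (τ (q, t')) := by
  set e := c.chart with he
  have hmem := c.mem_atlas
  obtain ⟨N, hN, J, hJo, hJ, δ, hδ, φ, σ, hφc, hσc, hbox⟩ :=
    exists_flowBox (contDiffAt_chartField hmem hp.1 hw) hW hg hmono
  have hgq : ∀ q ∈ c.closedOrthant ε, e q ∈ W → (π q : ℝ) = g (e q) := by
    intro q hq hqW
    have h1 := hgπ (e q) hqW ((hgC (e q) hqW).1 (by rwa [e.left_inv hq.1]))
    rwa [e.left_inv hq.1] at h1
  have hmonoN : ∀ x ∈ N, StrictMonoOn (fun s => g (φ (x, s))) (Ioo (-δ) δ) := fun x hx =>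
    hmono _ _ _ (hbox x hx).2.2.1
  have h0 : (0 : ℝ) ∈ Ioo (-δ) δ := ⟨by linarith, hδ⟩
  -- The flow is that of the extended field `w`; where `g` is positive, `w` agrees with `v` and the
  -- curve is integral for `v`.
  have hcurve : ∀ x ∈ N, ∀ s ∈ Ioo (-δ) δ, 0 < g (φ (x, s)) →
      IsMIntegralCurveAt (fun r => e.symm (φ (x, r))) v s := by
    intro x hx s hs hpos
    have hcont : ContinuousAt (fun r => g (φ (x, r))) s := by
      have h1 : ContinuousOn (fun r => g (φ (x, r))) (Ioo (-δ) δ) :=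
        hg.comp (fun r hr => ((hbox x hx).2.2.1 r hr).1.continuousAt.continuousWithinAt)
          fun r hr => ((hbox x hx).2.2.1 r hr).2
      exact h1.continuousAt (Ioo_mem_nhds hs.1 hs.2)
    filter_upwards [Ioo_mem_nhds hs.1 hs.2, hcont.eventually (Ioi_mem_nhds hpos)] with r hr hr'
    obtain ⟨h1, h2⟩ := (hbox x hx).2.2.1 r hr
    have h3 := ((mdifferentiable_of_mem_maximalAtlas hmem).mdifferentiableAt_symm
      (hWt h2)).hasMFDerivAt
    have h1' : HasMFDerivAt 𝓘(ℝ, ℝ) 𝓘(ℝ, EuclideanSpace ℝ (Fin n)) (fun r => φ (x, r)) r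
        ((1 : ℝ →L[ℝ] ℝ).smulRight (chartField e w (φ (x, r)))) :=
      (h1.hasFDerivAt.congr_fderiv (by
        refine ContinuousLinearMap.ext fun a => ?_
        change a • chartField c.chart w (φ (x, r)) = a • chartField e w (φ (x, r))
        rfl)).hasMFDerivAt
    refine (h3.comp r h1').congr_mfderiv (Eq.symm ?_)
    refine ContinuousLinearMap.ext fun (a : ℝ) => ?_
    change a • v (e.symm (φ (x, r))) = mfderiv 𝓘(ℝ, EuclideanSpace ℝ (Fin n)) (𝓡 n) e.symm
      (φ (x, r)) (a • chartField e w (φ (x, r)))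
    rw [hgv _ h2 hr', ← mfderiv_symm_chartField hmem w (hWt h2)]
    exact (map_smul (mfderiv 𝓘(ℝ, EuclideanSpace ℝ (Fin n)) (𝓡 n) e.symm (φ (x, r))) a
      (chartField e w (φ (x, r)))).symm
  refine ⟨e.source ∩ e ⁻¹' (N ∩ W), ?_, J, hJo, ?_, fun z => e.symm (φ (e z.1, σ (e z.1, z.2))),
    ?_, ?_⟩
  · exact inter_mem (e.open_source.mem_nhds hp.1)
      ((e.continuousAt hp.1).preimage_mem_nhds (inter_mem hN hW))
  · rw [hgq p hp (mem_of_mem_nhds hW)]; exact hJ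
  · have h1 : ContinuousOn (fun z : X × ℝ => (e z.1, z.2))
        (((e.source ∩ e ⁻¹' (N ∩ W)) ∩ c.closedOrthant ε) ×ˢ (J ∩ Ico 0 1)) :=
      (e.continuousOn.comp continuousOn_fst fun z hz => hz.1.1.1).prodMk continuousOn_snd
    have h2 := hσc.comp h1 fun z hz => ⟨hz.1.1.2.1, hz.2.1⟩
    have h3 := hφc.comp ((continuousOn_fst.comp h1 (mapsTo_univ _ _) :).prodMk h2)
      fun z hz => ⟨hz.1.1.2.1, ((hbox _ hz.1.1.2.1).2.2.2 z.2 hz.2.1).1⟩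
    refine e.continuousOn_symm.comp h3 fun z hz => ?_
    have h4 := (hbox _ hz.1.1.2.1).2.2.2 z.2 hz.2.1
    exact hWt ((hbox _ hz.1.1.2.1).2.2.1 _ h4.1).2
  · rintro q ⟨⟨hqs, hqN, hqW⟩, hqC⟩
    obtain ⟨h1, h2, h3, h4⟩ := hbox (e q) hqN
    have hπq := hgq q hqC hqW
    refine ⟨by rwa [hπq], ?_, ?_, ?_⟩
    · obtain ⟨h5, h6⟩ := h4 _ h1
      have h7 : σ (e q, g (e q)) = 0 := (hmonoN _ hqN).injOn h5 h0 (by simp only [h6, h2])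
      change e.symm (φ (e q, σ (e q, (π q : ℝ)))) = q
      rw [hπq, h7, h2, e.left_inv hqs]
    · rintro t ⟨ht, ht0, -⟩
      obtain ⟨h5, h6⟩ := h4 t ht
      have hmW := (h3 _ h5).2
      -- The flow of `w` may leave the orthant, but not at a level `t ≥ 0`, since `g` is negative
      -- outside.
      have hge : 0 ≤ g (φ (e q, σ (e q, t))) := by rw [h6]; exact ht0
      exact ⟨(hgC _ hmW).2 hge, (hgπ _ hmW hge).trans h6⟩
    · rintro t ⟨ht, -⟩ t' ⟨ht', -⟩ htpos htpos'
      obtain ⟨h5, h6⟩ := h4 t ht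
      obtain ⟨h5', h6'⟩ := h4 t' ht'
      set s := σ (e q, t)
      set s' := σ (e q, t')
      have hm : min s s' ∈ Ioo (-δ) δ := ⟨lt_min h5.1 h5'.1, (min_le_left _ _).trans_lt h5.2⟩
      have hgm : 0 < g (φ (e q, min s s')) := by
        rcases min_choice s s' with h | h <;> rw [h]
        · rw [h6]; exact htpos
        · rw [h6']; exact htpos'
      have hcont : ContinuousAt (fun r => g (φ (e q, r))) (min s s') := by
        have h7 : ContinuousOn (fun r => g (φ (e q, r))) (Ioo (-δ) δ) :=
          hg.comp (fun r hr => (h3 r hr).1.continuousAt.continuousWithinAt) fun r hr => (h3 r hr).2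
        exact h7.continuousAt (Ioo_mem_nhds hm.1 hm.2)
      -- Both points must lie on one curve inside `{π > 0}`. Starting slightly before the earlier of
      -- the two times, `g` is still positive, and it only increases afterwards.
      obtain ⟨a, ha, hga, haδ⟩ : ∃ a, a < min s s' ∧ 0 < g (φ (e q, a)) ∧ -δ < a := by
        have h8 : ∀ᶠ r in 𝓝[<] (min s s'), 0 < g (φ (e q, r)) :=
          nhdsWithin_le_nhds (hcont.eventually (Ioi_mem_nhds hgm))
        have h9 : ∀ᶠ r in 𝓝[<] (min s s'), -δ < r := nhdsWithin_le_nhds (Ioi_mem_nhds hm.1)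
        obtain ⟨a, h10, h11, h12⟩ := (h8.and (h9.and self_mem_nhdsWithin)).exists
        exact ⟨a, h12, h10, h11⟩
      have hposI : ∀ r ∈ Ioo a δ, 0 < g (φ (e q, r)) := fun r hr =>
        hga.trans (hmonoN _ hqN ⟨haδ, by linarith [hr.1, hr.2]⟩ ⟨haδ.trans hr.1, hr.2⟩ hr.1)
      refine ⟨fun r => e.symm (φ (e q, r)), a, δ, s, s', ⟨ha.trans_le (min_le_left _ _), h5.2⟩,
        ⟨ha.trans_le (min_le_right _ _), h5'.2⟩, ?_, ?_, rfl, rfl⟩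
      · exact IsMIntegralCurveAt.isMIntegralCurveOn fun r hr =>
          hcurve _ hqN r ⟨haδ.trans hr.1, hr.2⟩ (hposI r hr)
      · intro r hr
        have hrW := (h3 r ⟨haδ.trans hr.1, hr.2⟩).2
        change 0 < (π (e.symm (φ (e q, r))) : ℝ)
        rw [hgπ _ hrW (hposI r hr).le]
        exact hposI r hr

end Box

namespace AdaptedChart

variable {n : ℕ} {X : Type*} [TopologicalSpace X] [ChartedSpace (EuclideanSpace ℝ (Fin n)) X]
  {π : X → Ioo (-1 : ℝ) 1} {p : X} (A : AdaptedChart (n := n) π p)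

/-- If `π` is positive on the germ of an orthant, then it is the product of the absolute values
of the coordinates on this orthant. -/
theorem eq_prod_of_frequently_pos {ε : Fin A.k → ℤˣ} {r : X} (hk : 0 < A.k)
    (hpos : ∃ᶠ z in 𝓝[A.openOrthant ε] r, 0 < (π z : ℝ)) :
    ∀ q ∈ A.chart.source, (π q : ℝ) = ∏ i, ((ε i : ℤ) : ℝ) * A.coord i q := by
  obtain ⟨-, -, hprod⟩ := A.normal_form.resolve_left fun h => hk.ne' h.2
  obtain ⟨z, hz, hzO⟩ := (hpos.and_eventually self_mem_nhdsWithin).exists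
  have h1 : 0 < ∏ i, ((ε i : ℤ) : ℝ) * A.coord i z := Finset.prod_pos fun i _ => hzO.2 i
  rw [Finset.prod_mul_distrib, ← hprod z hzO.1] at h1
  -- At `z` both `π` and the product of the `ε i * x i` are positive, so the product of the signs is
  -- `1`.
  have h2 : (∏ i, ((ε i : ℤ) : ℝ)) = 1 := by
    have h3 : (((∏ i, ε i : ℤˣ) : ℤ) : ℝ) = ∏ i, ((ε i : ℤ) : ℝ) := by push_cast; rfl
    rw [← h3] at h1 ⊢
    rcases Int.units_eq_one_or (∏ i, ε i) with h4 | h4 <;> rw [h4] at h1 ⊢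
    · simp
    · simp at h1; linarith
  intro q hq
  rw [Finset.prod_mul_distrib, h2, one_mul, hprod q hq]

/-- Positivity of `π` on the germ of an orthant at one point propagates to the other points of
the closed orthant. -/
theorem eventually_pos {ε : Fin A.k → ℤˣ} {r q : X} (hcont : Continuous π)
    (hpos : ∃ᶠ z in 𝓝[A.openOrthant ε] r, 0 < (π z : ℝ)) (hq : q ∈ A.closedOrthant ε)
    (hπq : 0 ≤ (π q : ℝ)) : ∀ᶠ z in 𝓝[A.openOrthant ε] q, 0 < (π z : ℝ) := by
  rcases Nat.eq_zero_or_pos A.k with hk | hk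
  · have : IsEmpty (Fin A.k) := by rw [hk]; infer_instance
    have h1 : q ∉ specialFibre π := by
      rw [A.mem_iff q hq.1, Finset.univ_eq_empty, Finset.prod_empty]
      exact one_ne_zero
    have h2 : 0 < (π q : ℝ) := hπq.lt_of_ne' h1
    have h3 : ContinuousAt (fun z => (π z : ℝ)) q := by fun_prop
    exact nhdsWithin_le_nhds (h3.eventually (Ioi_mem_nhds h2))
  · filter_upwards [self_mem_nhdsWithin] with z hz
    rw [A.eq_prod_of_frequently_pos hk hpos z hz.1]
    exact Finset.prod_pos fun i _ => hz.2 i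

variable [IsManifold (𝓡 n) ∞ X]

/-- Flow boxes at the points of a closed orthant on whose germ `π` is positive. -/
theorem exists_orthant_box (hπ : IsSmoothSemistableDegeneration n π)
    {v w : (q : X) → TangentSpace (𝓡 n) q}
    (hv : ∀ q, 0 < (π q : ℝ) → 0 < dirDeriv (fun z => (π z : ℝ)) q (v q))
    {ε : Fin A.k → ℤˣ} (hp : p ∈ A.closedOrthant ε)
    (hpos : ∀ᶠ z in 𝓝[A.openOrthant ε] p, 0 < (π z : ℝ))
    (hw : ContMDiffAt (𝓡 n) (𝓡 n).tangent 1
      (fun x => (⟨x, w x⟩ : TangentBundle (𝓡 n) X)) p)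
    (hvw : ∀ᶠ q in 𝓝[A.openOrthant ε] p, v q = w q)
    (hin : ∀ i, A.coord i p = 0 → 0 < ((ε i : ℤ) : ℝ) * dirDeriv (A.coord i) p (w p)) :
    ∃ N ∈ 𝓝 p, ∃ J : Set ℝ, IsOpen J ∧ (π p : ℝ) ∈ J ∧ ∃ τ : X × ℝ → X,
      ContinuousOn τ ((N ∩ A.closedOrthant ε) ×ˢ (J ∩ Ico 0 1)) ∧
      ∀ q ∈ N ∩ A.closedOrthant ε, (π q : ℝ) ∈ J ∧ τ (q, π q) = q ∧
        (∀ t ∈ J ∩ Ico 0 1, τ (q, t) ∈ A.closedOrthant ε ∧ (π (τ (q, t)) : ℝ) = t) ∧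
        ∀ t ∈ J ∩ Ico 0 1, ∀ t' ∈ J ∩ Ico 0 1, 0 < t → 0 < t' →
          IntegralRel v {q | 0 < (π q : ℝ)} (τ (q, t)) (τ (q, t')) := by
  have hcont : Continuous π := hπ.isProper.continuous
  have := A.neBot_nhdsWithin_openOrthant hp
  set e := A.chart with he
  have hmem : e ∈ IsManifold.maximalAtlas (𝓡 n) ∞ X := A.mem_atlas
  have hsymm : Tendsto e.symm (𝓝 (e p)) (𝓝 p) := e.tendsto_symm hp.1
  have htgt : e.target ∈ 𝓝 (e p) := e.open_target.mem_nhds (e.map_source hp.1)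
  have hvw' : ∀ᶠ x in 𝓝 (e p), e.symm x ∈ A.openOrthant ε → v (e.symm x) = w (e.symm x) :=
    hsymm.eventually (eventually_nhdsWithin_iff.1 hvw)
  rcases Nat.eq_zero_or_pos A.k with hk | hk
  -- Without divisor coordinates the orthant is the whole chart and `π` itself serves as `g`, its
  -- derivative along `v = w` being positive.
  · have : IsEmpty (Fin A.k) := by rw [hk]; infer_instance
    have hO : ∀ q ∈ e.source, q ∈ A.openOrthant ε := fun q hq => ⟨hq, isEmptyElim⟩
    have hπp : 0 < (π p : ℝ) := by
      rw [nhdsWithin_eq_nhds.2 ((A.isOpen_openOrthant ε).mem_nhds (hO p hp.1))] at hpos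
      exact hpos.self_of_nhds
    have hpi : ContinuousOn (fun x => (π (e.symm x) : ℝ)) e.target :=
      (continuous_subtype_val.comp hcont).comp_continuousOn e.continuousOn_symm
    set W := {x | x ∈ e.target ∧ 0 < (π (e.symm x) : ℝ) ∧
      (e.symm x ∈ A.openOrthant ε → v (e.symm x) = w (e.symm x))} with hW
    have hWmem : W ∈ 𝓝 (e p) := by
      have h1 := (hpi.continuousAt htgt).eventually (Ioi_mem_nhds (by
        change 0 < (π (e.symm (e p)) : ℝ)
        rwa [e.left_inv hp.1]))
      filter_upwards [htgt, h1, hvw'] with x h2 h3 h4 using ⟨h2, h3, h4⟩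
    refine exists_orthant_box_of_strictMonoOn A.toNormalCrossingChart hp hw hWmem
      (fun x hx => hx.1) (g := fun x => (π (e.symm x) : ℝ)) (hpi.mono fun x hx => hx.1)
      (fun x hx => iff_of_true ⟨e.map_target hx.1, isEmptyElim⟩ hx.2.1.le)
      (fun x _ _ => rfl) (fun x hx _ => hx.2.2 (hO _ (e.map_target hx.1))) ?_
    intro x a b hx
    have hder : ∀ s ∈ Ioo a b, HasDerivAt (fun s => (π (e.symm (x s)) : ℝ))
        (dirDeriv (fun z => (π z : ℝ)) (e.symm (x s)) (w (e.symm (x s)))) s := by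
      intro s hs
      obtain ⟨h1, h2⟩ := hx s hs
      have hsrc := e.map_target h2.1
      have hF := (contDiffAt_comp_symm hmem hsrc
        hπ.normalCrossing.smooth.contMDiffAt).differentiableAt (by simp)
      have h3 := dirDeriv_eq_fderiv hmem hsrc hF
        (OpenPartialHomeomorph.eventuallyEq_comp_symm hsrc (fun z => (π z : ℝ))) (w (e.symm (x s)))
      rw [h3]
      rw [e.right_inv h2.1] at hF ⊢
      exact hF.hasFDerivAt.comp_hasDerivAt s h1
    refine strictMonoOn_of_deriv_pos (convex_Ioo a b)
      (fun s hs => (hder s hs).continuousAt.continuousWithinAt) fun s hs => ?_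
    rw [interior_Ioo] at hs
    have h2 := (hx s hs).2
    rw [(hder s hs).deriv, ← h2.2.2 (hO _ (e.map_target h2.1))]
    exact hv _ h2.2.1
  · obtain ⟨-, hp0, -⟩ := A.normal_form.resolve_left fun h => hk.ne' h.2
    have hprod := A.eq_prod_of_frequently_pos hk hpos.frequently
    have : Nonempty (Fin A.k) := ⟨⟨0, hk⟩⟩
    -- All `k` coordinates vanish at `p`, so `w` is strictly inward in each of them at `p` and, by
    -- continuity, on a neighbourhood. Every `ε i * x i` then increases along the flow, and so does
    -- `extendedProd`, also at the corner and outside the orthant.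
    set W := {x | x ∈ e.target ∧
      (∀ i : Fin A.k, 0 < ((ε i : ℤ) : ℝ) * chartField e w x (Fin.castLE A.k_le i)) ∧
      (e.symm x ∈ A.openOrthant ε → v (e.symm x) = w (e.symm x))} with hW
    have hWmem : W ∈ 𝓝 (e p) := by
      have h1 : ∀ i : Fin A.k, ∀ᶠ x in 𝓝 (e p),
          0 < ((ε i : ℤ) : ℝ) * chartField e w x (Fin.castLE A.k_le i) := by
        intro i
        have h2 : ContinuousAt
            (fun x => ((ε i : ℤ) : ℝ) * chartField e w x (Fin.castLE A.k_le i)) (e p) :=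
          continuousAt_const.mul
            ((EuclideanSpace.proj (𝕜 := ℝ) (Fin.castLE A.k_le i)).continuous.continuousAt.comp
              (contDiffAt_chartField hmem hp.1 hw).continuousAt)
        refine h2.eventually (Ioi_mem_nhds ?_)
        have h3 := hin i (by
          change e p (Fin.castLE A.k_le i) = 0
          rw [hp0]; rfl)
        rw [A.dirDeriv_coord i hp.1] at h3
        have h4 : chartField e w (e p) =
            mfderiv (𝓡 n) 𝓘(ℝ, EuclideanSpace ℝ (Fin n)) e p (w p) := by
          unfold chartField
          rw [e.left_inv hp.1]
        change 0 < ((ε i : ℤ) : ℝ) * chartField e w (e p) (Fin.castLE A.k_le i)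
        rw [h4]
        exact h3
      filter_upwards [htgt, eventually_all.2 h1, hvw'] with x h2 h3 h4 using ⟨h2, h3, h4⟩
    have hcoord : ∀ x ∈ e.target, ∀ i, A.coord i (e.symm x) = x (Fin.castLE A.k_le i) := by
      intro x hx i
      change e (e.symm x) (Fin.castLE A.k_le i) = _
      rw [e.right_inv hx]
    refine exists_orthant_box_of_strictMonoOn A.toNormalCrossingChart hp hw hWmem
      (fun x hx => hx.1)
      (g := fun x => extendedProd fun i : Fin A.k => ((ε i : ℤ) : ℝ) * x (Fin.castLE A.k_le i))
      ?_ ?_ ?_ ?_ ?_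
    · refine (continuous_extendedProd.comp (continuous_pi fun i => ?_)).continuousOn
      exact continuous_const.mul (EuclideanSpace.proj (𝕜 := ℝ) (Fin.castLE A.k_le i)).continuous
    · intro x hx
      rw [extendedProd_nonneg_iff]
      refine ⟨fun h i => ?_, fun h => ⟨e.map_target hx.1, fun i => ?_⟩⟩
      · rw [← hcoord x hx.1]; exact h.2 i
      · have := h i
        rw [← hcoord x hx.1] at this
        exact this
    · intro x hx h
      rw [hprod _ (e.map_target hx.1), extendedProd_of_nonneg (extendedProd_nonneg_iff.1 h)]
      exact Finset.prod_congr rfl fun i _ => by rw [hcoord x hx.1]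
    · intro x hx h
      refine hx.2.2 ⟨e.map_target hx.1, fun i => ?_⟩
      have := extendedProd_pos_iff.1 h i
      rw [← hcoord x hx.1] at this
      exact this
    · intro x a b hx s hs s' hs' hss
      refine extendedProd_lt fun i => ?_
      have hder : ∀ r ∈ Ioo a b, HasDerivAt
          (fun r => ((ε i : ℤ) : ℝ) * x r (Fin.castLE A.k_le i))
          (((ε i : ℤ) : ℝ) * chartField e w (x r) (Fin.castLE A.k_le i)) r := fun r hr =>
        ((EuclideanSpace.proj (𝕜 := ℝ) (Fin.castLE A.k_le i)).hasFDerivAt.comp_hasDerivAt r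
          (hx r hr).1).const_mul _
      refine strictMonoOn_of_deriv_pos (convex_Ioo a b)
        (fun r hr => (hder r hr).continuousAt.continuousWithinAt) (fun r hr => ?_) hs hs' hss
      rw [interior_Ioo] at hr
      rw [(hder r hr).deriv]
      exact (hx r hr).2.2.1 i

end AdaptedChart

/-! ### From a transport to a trivialization -/

section Trivialization

variable {Y : Type*} [TopologicalSpace Y] {p : Y → ℝ} {T : Y × ℝ → Y}

/-- A continuous transport between the levels of `p` identifies any two of them. -/
noncomputable def levelHomeomorph (hT : ContinuousOn T (univ ×ˢ Ico 0 1))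
    (hTp : ∀ y, T (y, p y) = y) (hpT : ∀ y, ∀ t ∈ Ico (0 : ℝ) 1, p (T (y, t)) = t)
    (hTT : ∀ y, ∀ s ∈ Ico (0 : ℝ) 1, ∀ t ∈ Ico (0 : ℝ) 1, T (T (y, s), t) = T (y, t))
    {s t : ℝ} (hs : s ∈ Ico (0 : ℝ) 1) (ht : t ∈ Ico (0 : ℝ) 1) :
    {y // p y = s} ≃ₜ {y // p y = t} where
  toFun y := ⟨T (y, t), hpT y t ht⟩
  invFun y := ⟨T (y, s), hpT y s hs⟩
  left_inv y := Subtype.ext <| by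
    have h := hTp y
    rw [y.2] at h
    exact (hTT y t ht s hs).trans h
  right_inv y := Subtype.ext <| by
    have h := hTp y
    rw [y.2] at h
    exact (hTT y s hs t ht).trans h
  continuous_toFun := (hT.comp_continuous (by fun_prop) fun _ => ⟨mem_univ _, ht⟩).subtype_mk _
  continuous_invFun := (hT.comp_continuous (by fun_prop) fun _ => ⟨mem_univ _, hs⟩).subtype_mk _

/-- A continuous transport between the levels of `p` trivializes `p`. -/
noncomputable def trivialization (hp : Continuous p) (h01 : ∀ y, p y ∈ Ico (0 : ℝ) 1)
    (hT : ContinuousOn T (univ ×ˢ Ico 0 1))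
    (hTp : ∀ y, T (y, p y) = y) (hpT : ∀ y, ∀ t ∈ Ico (0 : ℝ) 1, p (T (y, t)) = t)
    (hTT : ∀ y, ∀ s ∈ Ico (0 : ℝ) 1, ∀ t ∈ Ico (0 : ℝ) 1, T (T (y, s), t) = T (y, t)) :
    {y // p y = 0} × Ico (0 : ℝ) 1 ≃ₜ Y where
  toFun z := T (z.1, z.2)
  invFun y := (⟨T (y, 0), hpT y 0 ⟨le_rfl, one_pos⟩⟩, ⟨p y, h01 y⟩)
  left_inv z := by
    have h := hTp z.1
    rw [z.1.2] at h
    refine Prod.ext (Subtype.ext ?_) (Subtype.ext (hpT _ _ z.2.2))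
    exact (hTT z.1 z.2 z.2.2 0 ⟨le_rfl, one_pos⟩).trans h
  right_inv y := (hTT y 0 ⟨le_rfl, one_pos⟩ (p y) (h01 y)).trans (hTp y)
  continuous_toFun := hT.comp_continuous (by fun_prop) fun z => ⟨mem_univ _, z.2.2⟩
  continuous_invFun :=
    ((hT.comp_continuous (by fun_prop) fun _ => ⟨mem_univ _, le_rfl, one_pos⟩).subtype_mk
      _).prodMk (hp.subtype_mk _)

end Trivialization

/-! ### Transport on the positive half and the main theorem -/

namespace RealOrientedBlowup

variable {n : ℕ} {X : Type*} [TopologicalSpace X] [ChartedSpace (EuclideanSpace ℝ (Fin n)) X]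
  {D : Set X}

/-- Off the divisor the side carries no information beyond the point, which makes the blow-down map
injective there. -/
theorem side_eq_nhds {y : RealOrientedBlowup n D} (hy : y.blowDown ∉ D) :
    y.side = 𝓝 y.blowDown := by
  obtain ⟨c, ε, q, rfl⟩ := y.exists_orthantMap
  refine nhdsWithin_eq_nhds.2 ((c.isOpen_openOrthant ε).mem_nhds ⟨q.2.1, fun i => ?_⟩)
  refine (q.2.2 i).lt_of_ne' (mul_ne_zero (by simp) ?_)
  change (q : X) ∉ D at hy
  rw [c.mem_iff q q.2.1, Finset.prod_eq_zero_iff] at hy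
  push Not at hy
  exact hy i (Finset.mem_univ i)

theorem exists_blowDown_eq {c : NormalCrossingChart n D} {q : X} (hq : q ∈ c.chart.source)
    (hD : q ∉ D) : ∃ y : RealOrientedBlowup n D, y.blowDown = q :=
  ⟨orthantMap c (c.signs q)
    ⟨q, c.openOrthant_subset_closedOrthant _ (c.mem_openOrthant_signs hq hD)⟩, rfl⟩

variable {π : X → Ioo (-1 : ℝ) 1}

theorem mem_positiveHalf_of_pos {y : RealOrientedBlowup n (specialFibre π)} (hπ : Continuous π)
    (hy : 0 < (π y.blowDown : ℝ)) : liftedMap π y ∈ BlownUpInterval.positiveHalf := by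
  have h : ContinuousAt (fun q => (π q : ℝ)) y.blowDown := by fun_prop
  rw [liftedMap_mem_positiveHalf_iff, side_eq_nhds (D := specialFibre π) hy.ne']
  exact h.eventually (Ioi_mem_nhds hy)

theorem liftedMap_eq_inr (hπ : Continuous π) {y : RealOrientedBlowup n (specialFibre π)}
    (hy : liftedMap π y ∈ BlownUpInterval.positiveHalf) :
    ∃ h : (π y.blowDown : ℝ) ∈ Ico (0 : ℝ) 1, liftedMap π y = Sum.inr ⟨π y.blowDown, h⟩ := by
  obtain ⟨t, ht⟩ := hy
  have h := congrArg Subtype.val ((isBlowupOfMap_liftedMap hπ).comm y)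
  rw [← ht] at h
  change (t : ℝ) = π y.blowDown at h
  exact ⟨h ▸ t.2, by rw [← ht]; exact congrArg _ (Subtype.ext h)⟩

theorem isClosed_positiveHalf (hπ : Continuous π) :
    IsClosed (liftedMap (n := n) π ⁻¹' BlownUpInterval.positiveHalf) :=
  isClosed_range_inr.preimage (isBlowupOfMap_liftedMap hπ).continuous

variable [T2Space X] [IsManifold (𝓡 n) ∞ X]

/-- A continuous transport between the levels of `π` on the positive half of the blow-up. -/
theorem exists_transport (hπ : IsSmoothSemistableDegeneration n π) :
    ∃ T : (liftedMap (n := n) π ⁻¹' BlownUpInterval.positiveHalf) × ℝ →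
        (liftedMap (n := n) π ⁻¹' BlownUpInterval.positiveHalf),
      ContinuousOn T (univ ×ˢ Ico 0 1) ∧ (∀ y, T (y, π y.1.blowDown) = y) ∧
      (∀ y, ∀ t ∈ Ico (0 : ℝ) 1, (π (T (y, t)).1.blowDown : ℝ) = t) ∧
      ∀ y, ∀ s ∈ Ico (0 : ℝ) 1, ∀ t ∈ Ico (0 : ℝ) 1, T (T (y, s), t) = T (y, t) := by
  classical
  have hcont : Continuous π := hπ.isProper.continuous
  have hα : Continuous (blowDown : RealOrientedBlowup n (specialFibre π) → X) :=
    continuous_blowDown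
  obtain ⟨v, hv, hvw⟩ := exists_ascending_vectorField hπ
  -- Where `π > 0` the point lies in an open orthant, whose germ is a full neighbourhood, so `v`
  -- agrees locally with a `C¹` field.
  have hvsmooth : ∀ q ∈ {q | 0 < (π q : ℝ)}, ContMDiffAt (𝓡 n) (𝓡 n).tangent 1
      (fun x => (⟨x, v x⟩ : TangentBundle (𝓡 n) X)) q := by
    intro q hq
    obtain ⟨c, hc⟩ := exists_normalCrossingChart hπ q
    have hO := c.mem_openOrthant_signs hc (ne_of_gt hq)
    obtain ⟨w, hw, hvw', -⟩ := hvw c (c.signs q) q (c.openOrthant_subset_closedOrthant _ hO)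
    rw [nhdsWithin_eq_nhds.2 ((c.isOpen_openOrthant _).mem_nhds hO)] at hvw'
    refine hw.congr_of_eventuallyEq ?_
    filter_upwards [hvw'] with x hx
    rw [hx]
  refine exists_transport_of_relation_pos
    (p := fun y : liftedMap (n := n) π ⁻¹' BlownUpInterval.positiveHalf =>
      (π y.1.blowDown : ℝ))
    (R := fun y z => IntegralRel v {q | 0 < (π q : ℝ)} y.1.blowDown z.1.blowDown)
    (by fun_prop) (fun y => (liftedMap_eq_inr hcont y.2).1) (fun c hc => ?_)
    (fun _ _ h => h.symm) (fun _ _ _ h h' => .trans hvsmooth h h') (fun y z h hyz => ?_) ?_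
  · have hK : IsCompact ((Subtype.val : Ioo (-1 : ℝ) 1 → ℝ) ⁻¹' Icc 0 c) :=
      IsInducing.subtypeVal.isCompact_preimage_iff (by
        rw [Subtype.range_val]
        exact fun t ht => ⟨neg_one_lt_zero.trans_le ht.1, ht.2.trans_lt hc⟩) |>.2 isCompact_Icc
    have h1 := (hπ.isProper.comp (isProperMap_blowDown (n := n)
      (exists_normalCrossingChart hπ))).isCompact_preimage hK
    exact (isClosed_positiveHalf hcont).isClosedEmbedding_subtypeVal.isCompact_preimage h1
  -- Related points lie on a curve inside `{π > 0}`, where the blow-down map is injective; equality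
  -- can be checked in `X`.
  · have hy : y.1.blowDown ∉ specialFibre π := by
      obtain ⟨γ, a, b, s, t, hs, -, -, hU, h1, -⟩ := h
      rw [← h1]
      exact (hU s hs).ne'
    have h1 : y.1.blowDown = z.1.blowDown := h.eq_of_apply_eq hπ.normalCrossing.smooth hv hyz
    refine Subtype.ext (ext_iff.2 ⟨h1, ?_⟩)
    rw [side_eq_nhds hy, side_eq_nhds (h1 ▸ hy), h1]
  · rintro ⟨y₀, hy₀⟩
    obtain ⟨A⟩ := exists_adaptedChart hπ y₀.blowDown
    obtain ⟨ε, q₀, hq₀⟩ := y₀.exists_orthantMap_eq A.toNormalCrossingChart A.mem_source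
    have hq₀' : (q₀ : X) = y₀.blowDown := congrArg blowDown hq₀
    have hp : y₀.blowDown ∈ A.closedOrthant ε := mem_of_eq_of_mem hq₀'.symm q₀.2
    have hpos : ∀ᶠ z in 𝓝[A.openOrthant ε] y₀.blowDown, 0 < (π z : ℝ) := by
      have h1 := liftedMap_mem_positiveHalf_iff.1 hy₀
      rw [← hq₀] at h1
      change ∀ᶠ z in 𝓝[A.openOrthant ε] (q₀ : X), _ at h1
      rwa [hq₀'] at h1
    have := A.neBot_nhdsWithin_openOrthant hp
    obtain ⟨w, hw, hvw', hin⟩ := hvw A.toNormalCrossingChart ε _ hp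
    obtain ⟨N, hN, J, hJo, hJ, τ, hτ, hbox⟩ :=
      A.exists_orthant_box hπ hv hp hpos hw hvw' hin
    -- The box moves points of `X` within one closed orthant, and its values are lifted through that
    -- same orthant. Positivity of `π` on the orthant keeps the lift in the positive half.
    have hlift : ∀ q (hq : q ∈ A.closedOrthant ε), 0 ≤ (π q : ℝ) →
        liftedMap π (orthantMap A.toNormalCrossingChart ε ⟨q, hq⟩) ∈
          BlownUpInterval.positiveHalf := fun q hq h =>
      liftedMap_mem_positiveHalf_iff.2 (A.eventually_pos hcont hpos.frequently hq h)
    set M : Set (liftedMap (n := n) π ⁻¹' BlownUpInterval.positiveHalf) :=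
      {y | y.1 ∈ range (orthantMap A.toNormalCrossingChart ε) ∧ y.1.blowDown ∈ N} with hM
    have hMmem : M ∈ 𝓝 (⟨y₀, hy₀⟩ : liftedMap (n := n) π ⁻¹' BlownUpInterval.positiveHalf) :=
      inter_mem (((isOpen_range_orthantMap _ _).preimage continuous_subtype_val).mem_nhds
        ⟨q₀, hq₀⟩) ((hα.comp continuous_subtype_val).continuousAt.preimage_mem_nhds hN)
    have hMC : ∀ y ∈ M, ∃ h : y.1.blowDown ∈ A.closedOrthant ε,
        orthantMap A.toNormalCrossingChart ε ⟨y.1.blowDown, h⟩ = y.1 := by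
      rintro ⟨_, hy⟩ ⟨⟨q, rfl⟩, -⟩
      exact ⟨q.2, rfl⟩
    have hτC : ∀ y ∈ M, ∀ t ∈ J ∩ Ico 0 1, ∃ h : τ (y.1.blowDown, t) ∈ A.closedOrthant ε,
        liftedMap π (orthantMap A.toNormalCrossingChart ε ⟨τ (y.1.blowDown, t), h⟩) ∈
          BlownUpInterval.positiveHalf := by
      intro y hy t ht
      obtain ⟨h1, h2⟩ := (hbox _ ⟨hy.2, (hMC y hy).1⟩).2.2.1 t ht
      exact ⟨h1, hlift _ h1 (by rw [h2]; exact ht.2.1)⟩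
    -- The fallback value `z.1` is never used over `M ×ˢ (J ∩ Ico 0 1)`, by `hτC`.
    set σ : (liftedMap (n := n) π ⁻¹' BlownUpInterval.positiveHalf) × ℝ →
        (liftedMap (n := n) π ⁻¹' BlownUpInterval.positiveHalf) := fun z =>
      if h : ∃ h : τ (z.1.1.blowDown, z.2) ∈ A.closedOrthant ε,
          liftedMap π (orthantMap A.toNormalCrossingChart ε ⟨τ (z.1.1.blowDown, z.2), h⟩) ∈
            BlownUpInterval.positiveHalf
      then ⟨orthantMap A.toNormalCrossingChart ε ⟨τ (z.1.1.blowDown, z.2), h.1⟩, h.2⟩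
      else z.1 with hσ_def
    have hσ : ∀ y (hy : y ∈ M) t (ht : t ∈ J ∩ Ico 0 1), (σ (y, t)).1 =
        orthantMap A.toNormalCrossingChart ε ⟨τ (y.1.blowDown, t), (hτC y hy t ht).1⟩ := by
      intro y hy t ht
      rw [hσ_def]
      simp only [dif_pos (hτC y hy t ht)]
    have hσα : ∀ y ∈ M, ∀ t ∈ J ∩ Ico 0 1, (σ (y, t)).1.blowDown = τ (y.1.blowDown, t) :=
      fun y hy t ht => congrArg blowDown (hσ y hy t ht)
    refine ⟨M, hMmem, J, hJo, hJ, σ, ?_, fun y hy => ?_⟩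
    · rw [IsInducing.subtypeVal.continuousOn_iff, continuousOn_iff_continuous_domRestrict]
      have h1 : Continuous fun z : M ×ˢ (J ∩ Ico 0 1) => τ (z.1.1.1.blowDown, z.1.2) :=
        hτ.comp_continuous (by fun_prop) fun z =>
          ⟨⟨z.2.1.2, (hMC _ z.2.1).1⟩, z.2.2⟩
      convert (continuous_orthantMap A.toNormalCrossingChart ε).comp
        (h1.subtype_mk fun z => (hτC _ z.2.1 _ z.2.2).1) using 1
      funext z
      exact hσ _ z.2.1 _ z.2.2
    · obtain ⟨hyC, hyo⟩ := hMC y hy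
      obtain ⟨h1, h2, h3, h4⟩ := hbox _ ⟨hy.2, hyC⟩
      have h01 := (liftedMap_eq_inr hcont y.2).1
      refine ⟨h1, Subtype.ext ?_, fun t ht => ?_, fun t ht t' ht' htp htp' => ?_⟩
      · exact (hσ y hy _ ⟨h1, h01⟩).trans ((congrArg _ (Subtype.ext h2)).trans hyo)
      · rw [hσα y hy t ht]
        exact (h3 t ht).2
      · rw [hσα y hy t ht, hσα y hy t' ht']
        exact h4 t ht t' ht' htp htp'

/-- The positive half of the blow-up maps homeomorphically to `X` over a positive value. -/
theorem nonempty_level_homeomorph (hπ : IsSmoothSemistableDegeneration n π)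
    (t : Ioo (-1 : ℝ) 1) (ht : 0 < (t : ℝ)) :
    Nonempty ({y : liftedMap (n := n) π ⁻¹' BlownUpInterval.positiveHalf //
      (π y.1.blowDown : ℝ) = t} ≃ₜ (π ⁻¹' {t})) := by
  have hcont : Continuous π := hπ.isProper.continuous
  have hα : Continuous (blowDown : RealOrientedBlowup n (specialFibre π) → X) :=
    continuous_blowDown
  have hK := (hπ.isProper.comp (isProperMap_blowDown (n := n)
    (exists_normalCrossingChart hπ))).isCompact_preimage (isCompact_singleton (x := t))
  have h1 := (isClosed_positiveHalf (n := n)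
    hcont).isClosedEmbedding_subtypeVal.isCompact_preimage hK
  -- Compactness of the level upgrades the continuous bijection `F` onto a Hausdorff fibre to a
  -- homeomorphism.
  have : CompactSpace {y : liftedMap (n := n) π ⁻¹' BlownUpInterval.positiveHalf //
      (π y.1.blowDown : ℝ) = t} := by
    refine isCompact_iff_compactSpace.1 ?_
    refine (congrArg IsCompact (Set.ext fun y => ?_)).mp h1
    exact Subtype.ext_iff
  let F : {y : liftedMap (n := n) π ⁻¹' BlownUpInterval.positiveHalf //
      (π y.1.blowDown : ℝ) = t} → π ⁻¹' {t} := fun y => ⟨y.1.1.blowDown, Subtype.ext y.2⟩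
  have hF : Function.Bijective F := by
    refine ⟨fun y z hyz => ?_, fun q => ?_⟩
    · have h2 : y.1.1.blowDown = z.1.1.blowDown := congrArg Subtype.val hyz
      have hy : y.1.1.blowDown ∉ specialFibre π := fun h => ht.ne' (y.2.symm.trans h)
      refine Subtype.ext (Subtype.ext (ext_iff.2 ⟨h2, ?_⟩))
      rw [side_eq_nhds hy, side_eq_nhds (h2 ▸ hy), h2]
    · have h2 : (π q : ℝ) = t := congrArg Subtype.val q.2
      obtain ⟨c, hc⟩ := exists_normalCrossingChart hπ (q : X)
      obtain ⟨y, hy⟩ := exists_blowDown_eq hc fun h => ht.ne' (h2.symm.trans h)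
      exact ⟨⟨⟨y, mem_positiveHalf_of_pos hcont (by rw [hy, h2]; exact ht)⟩,
        by rw [hy, h2]⟩, Subtype.ext hy⟩
  have hFc : Continuous F := Continuous.subtype_mk (by fun_prop) _
  exact ⟨Continuous.homeoOfEquivCompactToT2 (f := Equiv.ofBijective F hF) hFc⟩

/-- The fibre over `0⁺` as a level of `π` on the positive half. -/
noncomputable def zeroFibreHomeomorph (hπ : Continuous π) :
    (liftedMap (n := n) π ⁻¹' {BlownUpInterval.zeroPos}) ≃ₜ
      {y : liftedMap (n := n) π ⁻¹' BlownUpInterval.positiveHalf //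
        (π y.1.blowDown : ℝ) = 0} where
  toFun y := ⟨⟨y, ⟨_, y.2.symm⟩⟩, by
    have h := congrArg Subtype.val ((isBlowupOfMap_liftedMap hπ).comm y.1)
    rw [y.2] at h
    exact h.symm⟩
  invFun y := ⟨y.1, by
    obtain ⟨h, h'⟩ := liftedMap_eq_inr hπ y.1.2
    exact h'.trans (congrArg _ (Subtype.ext y.2))⟩
  left_inv _ := rfl
  right_inv _ := rfl
  continuous_toFun := by fun_prop
  continuous_invFun := by fun_prop

end RealOrientedBlowup

theorem mainTheorem1 (n : ℕ) {X : Type*} [TopologicalSpace X] [T2Space X]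
    [ChartedSpace (EuclideanSpace ℝ (Fin n)) X] [IsManifold (𝓡 n) ∞ X]
    (π : X → Ioo (-1 : ℝ) 1) (hπ : IsSmoothSemistableDegeneration n π) :
    (∃! π' : RealOrientedBlowup n (specialFibre π) → BlownUpInterval, IsBlowupOfMap n π π') ∧
    ∀ π' : RealOrientedBlowup n (specialFibre π) → BlownUpInterval, IsBlowupOfMap n π π' →
      (∃ H : ((π' ⁻¹' {BlownUpInterval.zeroPos}) × Ico (0 : ℝ) 1) ≃ₜ
          (π' ⁻¹' BlownUpInterval.positiveHalf),
        ∀ (x : π' ⁻¹' {BlownUpInterval.zeroPos}) (t : Ico (0 : ℝ) 1),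
          π' (H (x, t)) = Sum.inr t) ∧
      ∀ t : Ioo (-1 : ℝ) 1, 0 < (t : ℝ) →
        Nonempty ((π' ⁻¹' {BlownUpInterval.zeroPos}) ≃ₜ (π ⁻¹' {t})) := by
  have hcont : Continuous π := hπ.isProper.continuous
  refine ⟨⟨RealOrientedBlowup.liftedMap π, RealOrientedBlowup.isBlowupOfMap_liftedMap hcont,
    fun f hf => hf.eq_liftedMap hcont⟩, fun f hf => ?_⟩
  obtain rfl := hf.eq_liftedMap hcont
  obtain ⟨T, hT, hTp, hpT, hTT⟩ := RealOrientedBlowup.exists_transport hπ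
  have hα := RealOrientedBlowup.continuous_blowDown (n := n) (D := specialFibre π)
  refine ⟨⟨((RealOrientedBlowup.zeroFibreHomeomorph hcont).prodCongr (Homeomorph.refl _)).trans
    (trivialization (by fun_prop) (fun y => (RealOrientedBlowup.liftedMap_eq_inr hcont y.2).1)
      hT hTp hpT hTT), fun x t => ?_⟩, fun t ht => ?_⟩
  · obtain ⟨h1, h2⟩ := RealOrientedBlowup.liftedMap_eq_inr hcont (T (_, (t : ℝ))).2
    exact h2.trans (congrArg _ (Subtype.ext (hpT _ t t.2)))
  · obtain ⟨e⟩ := RealOrientedBlowup.nonempty_level_homeomorph hπ t ht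
    exact ⟨((RealOrientedBlowup.zeroFibreHomeomorph hcont).trans
      (levelHomeomorph hT hTp hpT hTT ⟨le_rfl, one_pos⟩ ⟨ht.le, t.2.2⟩)).trans e⟩
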